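/- Let $r\ge 3$ and $t\ge 1$ be integers, $s=\lfloor (t-1)/2\rfloor$. Graphs are finite and may have parallel edges; two parallel edges form a cycle of length $2$, a loop a cycle of length $1$; the girth is the least length of a cycle ($\infty$ if there is none). A linear code $\mathcal C\subseteq\mathbb F_q^n$ of dimension $k$ is an *$(n,k,r,t)$ S-LR code* (recovers sequentially from $t$ erasures with locality $r$) if every set of $\ell\le t$ code symbols can be ordered $c_{i_1},\dots,c_{i_\ell}$ so that for each $j$ there is $S_j\subseteq[n]$ with $|S_j|\le r$, $S_j\cap\{i_j,\dots,i_\ell\}=\emptyset$, such that on $\mathcal C$ the symbol $c_{i_j}$ is a fixed linear combination of the symbols $c_l$, $l\in S_j$. Put $$R(r,t)=\frac{r^{s+1}}{r^{s+1}+2\sum_{i=0}^{s}r^i}\ (t\text{ even}),\qquad R(r,t)=\frac{r^{s+1}}{r^{s+1}+2\sum_{i=1}^{s}r^i+1}\ (t\text{ odd}).$$ A *tree-like graph* $\mathcal G_0$ with parameters $(r,t,a_0)$ is a loopless graph whose node set is a disjoint union $\{V_\infty\}\sqcup V_0\sqcup\dots\sqcup V_s$, such that $V_\infty$ has degree $a_0$,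 all other nodes have degree $r+1$, and, with $V_{-1}=\{V_\infty\}$: each edge joins $V_{i-1}$ to $V_i$ for some $0\le i\le s$ or, for $t$ even only, joins two nodes of $V_s$; each node of $V_i$ has exactly one edge to $V_{i-1}$, for $0\le i\le s$ if $t$ is even and for $0\le i\le s-1$ if $t$ is odd. Its *base graph* is $\mathcal G_0$ with the node $V_\infty$ removed. An *auxiliary graph* for $(r,t)$ is a graph $\mathcal A$ with an even number of nodes, all of degree $\ge r+1$, of girth $\ge t+1$, with a colouring of a subset of its edges by $r+1$ colours such that each colour class is a perfect matching of $\mathcal A$. The *expansion* of a graph $B$, edge-coloured by the same $r+1$ colours, by $\mathcal A$ has node set $V(B)\times V(\mathcal A)$; an edge $vx$ of $B$ and an edge $uw$ of $\mathcal A$ of the same colour give the edges $(v,u)(x,w)$ and $(v,w)(x,u)$. Then: 1. Let $\mathcal G_0$ be tree-like with parameters $(r,t,a_0)$. The binary code with parity-check matrix the node-edge incidence matrix of $\mathcal G_0$ is an S-LR code with parameters $(r,t)$ if and only if $\mathcal G_0$ has girth $\ge t+1$. Over any finite field $\mathbb F_q$, a code whose parity-check matrix has the zero pattern of this incidence matrix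 without the row of $V_\infty$ is an S-LR code with parameters $(r,t)$ if $\mathcal G_0$ has girth $\ge t+1$. If $a_0>0$, all these codes have rate exactly $R(r,t)$. 2. The expansion of any graph that is properly edge-coloured by $r+1$ colours by an auxiliary graph for $(r,t)$ has girth $\ge t+1$. If the graph is the base graph of a tree-like graph $\mathcal G_0$ with parameters $(r,t,a_0)$, and a new node $V_\infty'$ is joined to the nodes $(v,u)$, $u\in V(\mathcal A)$, by as many edges as join $V_\infty$ to $v$ in $\mathcal G_0$, then the result is tree-like with parameters $(r,t,a_0|V(\mathcal A)|)$, with node sets $V_i\times V(\mathcal A)$, and has girth $\ge t+1$. 3. There is a tree-like graph with parameters $(r,t,a_0)$, $a_0>0$, without parallel edges if $t\ge2$, whose base graph has a proper edge colouring by $r+1$ colours; one can take $a_0=r+1$ for $t$ odd and $a_0=4$ for $t\ge 6$ even. There is a nonempty auxiliary graph for $(r,t)$. 4. Every $(n,k,r,t)$ S-LR code over a finite field, $n\ge 1$, satisfies $k/n\le R(r,t)$, and this bound is tight: there is a tree-like graph with parameters $(r,t,a_0)$, $a_0>0$, of girth $\ge t+1$, and its binary code is an S-LR code with parameters $(r,t)$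 and rate exactly $R(r,t)$. -/

import Mathlib

open Graph
open scoped Classical

namespace Graph

variable {α β γ δ ι : Type*}

/-- A cycle of length `k + 1` in a multigraph: distinct vertices `x 0, …, x k` and distinct edges
`e 0, …, e k` such that `e i` joins `x i` to `x (i + 1)`, indices being read cyclically. A loop is
a cycle of length `1` and a pair of parallel edges is a cycle of length `2`. -/
structure IsCycle (G : Graph α β) (k : ℕ) (x : Fin (k + 1) → α) (e : Fin (k + 1) → β) : Prop where
  vertex_injective : Function.Injective x
  edge_injective : Function.Injective e
  isLink : ∀ i, G.IsLink (e i) (x i) (x (i + 1))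

/-- The girth: the least length of a cycle, `⊤` if there is no cycle. -/
noncomputable def girth (G : Graph α β) : ℕ∞ :=
  ⨅ (k : ℕ) (_ : ∃ x e, G.IsCycle k x e), ((k + 1 : ℕ) : ℕ∞)

/-- The degree of a vertex (only used for graphs that turn out to be loopless). -/
noncomputable def deg (G : Graph α β) (v : α) : ℕ := {e | G.Inc e v}.ncard

/-- A proper edge colouring: distinct edges that share a vertex have distinct colours. -/
def IsProperEdgeColouring (G : Graph α β) (c : β → ι) : Prop :=
  ∀ ⦃v e f⦄, G.Inc e v → G.Inc f v → c e = c f → e = f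

/-- The node-edge incidence matrix over `𝔽₂`. -/
noncomputable def incidenceMatrix (G : Graph α β) : Matrix V(G) E(G) (ZMod 2) :=
  fun v e => if G.Inc e.1 v.1 then 1 else 0

/-- The tree-like graph `G₀` with parameters `r`, `t`, `a₀`. With `s = ⌊(t - 1) / 2⌋` its node set
is the disjoint union of `{V_∞} = {root}` and `V_0, …, V_s`; here `lev` is `0` at `root` and `i + 1`
on `V_i`. Every node other than `root` has degree `r + 1` and `root` has degree `a₀`.
* Each edge joins consecutive levels, or, if `t` is even, two distinct nodes of the last level.
* Each node other than `root` has exactly one edge to a lower level; for odd `t` this is required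
  only of nodes that are not in the last level (there all `r + 1` edges go to lower levels).

Equivalently, the incidence matrix of `G₀` is the staircase matrix with an extra top row. -/
structure IsTreeLike (G : Graph α β) (r t a₀ : ℕ) (root : α) (lev : α → ℕ) : Prop where
  root_mem : root ∈ V(G)
  lev_eq_zero : ∀ v ∈ V(G), lev v = 0 ↔ v = root
  lev_le : ∀ v ∈ V(G), lev v ≤ (t - 1) / 2 + 1
  deg_root : G.deg root = a₀
  deg_eq : ∀ v ∈ V(G), v ≠ root → G.deg v = r + 1
  isLink : ∀ ⦃e x y⦄, G.IsLink e x y → lev y = lev x + 1 ∨ lev x = lev y + 1 ∨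
    (Even t ∧ lev x = (t - 1) / 2 + 1 ∧ lev y = (t - 1) / 2 + 1 ∧ x ≠ y)
  existsUnique_down : ∀ v ∈ V(G), v ≠ root → (Odd t → lev v ≤ (t - 1) / 2) →
    ∃! e, ∃ u, G.IsLink e v u ∧ lev u < lev v

/-- The base graph of `G₀`: the node `V_∞` is removed, together with its edges. -/
def base (G : Graph α β) (root : α) : Graph α β := G.deleteVerts {root}

/-- An auxiliary graph for the parameters `r`, `t`, with a colouring `c` of a subset of its edges
(the edges of colour `none` are the uncoloured ones) by `r + 1` colours, each colour class of which
is a perfect matching. -/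
structure IsAuxiliary (A : Graph γ δ) (r t : ℕ) (c : δ → Option (Fin (r + 1))) : Prop where
  even_card : Even V(A).ncard
  le_deg : ∀ u ∈ V(A), r + 1 ≤ A.deg u
  le_girth : ((t + 1 : ℕ) : ℕ∞) ≤ A.girth
  perfectMatching : ∀ i : Fin (r + 1), ∀ u ∈ V(A), ∃! f, A.Inc f u ∧ c f = some i

/-- The expansion of an edge-coloured graph `B` by a (partially) edge-coloured graph `A`: its nodes
are `V(B) × V(A)`, and an edge `vx` of `B` and an edge `uw` of `A` of the same colour give rise to
the two edges `(v, u)(x, w)` and `(v, w)(x, u)`. -/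
def expand (B : Graph α β) (A : Graph γ δ) (cB : β → ι) (cA : δ → Option ι) :
    Graph (α × γ) (β × δ × Sym2 (α × γ)) where
  vertexSet := V(B) ×ˢ V(A)
  IsLink p x y := B.IsLink p.1 x.1 y.1 ∧ A.IsLink p.2.1 x.2 y.2 ∧ cA p.2.1 = some (cB p.1) ∧
    p.2.2 = s(x, y)
  isLink_symm := fun _ _ => ⟨fun _ _ h => ⟨h.1.symm, h.2.1.symm, h.2.2.1, by
    rw [h.2.2.2, Sym2.eq_swap]⟩⟩
  eq_or_eq_of_isLink_of_isLink := fun p x y v w h h' => by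
    have := h.2.2.2.symm.trans h'.2.2.2
    rcases Sym2.eq_iff.1 this with h | h
    · exact Or.inl h.1
    · exact Or.inr h.1
  left_mem_of_isLink := fun p x y h => ⟨h.1.left_mem, h.2.1.left_mem⟩

/-- The expansion of the base graph of `G`, with a new root `none` that is joined by an edge to each
copy `(v, u)`, `u ∈ V(A)`, of each neighbour `v` of `root` (if several edges of `G` join `root` to
`v`, which occurs only for `t = 1`, there is one new edge for each of them). -/
def expandRoot (G : Graph α β) (root : α) (A : Graph γ δ) (cB : β → ι) (cA : δ → Option ι) :
    Graph (Option (α × γ)) ((β × δ × Sym2 (α × γ)) ⊕ (β × γ)) where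
  vertexSet := insert none (some '' V(expand (G.base root) A cB cA))
  IsLink e p q :=
    match e with
    | .inl e => ∃ x y, p = some x ∧ q = some y ∧ (expand (G.base root) A cB cA).IsLink e x y
    | .inr (d, u) => ∃ v, v ≠ root ∧ u ∈ V(A) ∧ G.IsLink d root v ∧
        ((p = none ∧ q = some (v, u)) ∨ (p = some (v, u) ∧ q = none))
  isLink_symm := by
    rintro (e | ⟨d, u⟩) -
    · exact ⟨fun p q ⟨x, y, hp, hq, h⟩ => ⟨y, x, hq, hp, h.symm⟩⟩
    · exact ⟨fun p q ⟨v, hv, hu, h, h'⟩ => ⟨v, hv, hu, h, h'.symm.imp And.symm And.symm⟩⟩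
  eq_or_eq_of_isLink_of_isLink := by
    rintro (e | ⟨d, u⟩) x y v w h h'
    · obtain ⟨a, b, rfl, rfl, h⟩ := h
      obtain ⟨a', b', rfl, rfl, h'⟩ := h'
      exact (h.left_eq_or_eq h').imp (congrArg some) (congrArg some)
    · obtain ⟨a, -, -, h1, h⟩ := h
      obtain ⟨a', -, -, h1', h'⟩ := h'
      obtain rfl := h1.right_unique h1'
      rcases h with ⟨rfl, rfl⟩ | ⟨rfl, rfl⟩ <;> rcases h' with ⟨rfl, rfl⟩ | ⟨rfl, rfl⟩ <;> simp
  left_mem_of_isLink := by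
    rintro (e | ⟨d, u⟩) x y h
    · obtain ⟨a, b, rfl, rfl, h⟩ := h
      exact Set.mem_insert_of_mem _ ⟨a, h.left_mem, rfl⟩
    · obtain ⟨v, hv, hu, h, ⟨rfl, rfl⟩ | ⟨rfl, rfl⟩⟩ := h
      · exact Set.mem_insert _ _
      · refine Set.mem_insert_of_mem _ ⟨(v, u), ⟨?_, hu⟩, rfl⟩
        simpa [base] using ⟨h.right_mem, hv⟩

end Graph

/-- The linear code over `F`, of block length `Nat.card n`, with parity-check matrix `H`. -/
noncomputable def parityCheckCode {m n F : Type*} [Field F] [Finite n] (H : Matrix m n F) :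
    Submodule F (n → F) :=
  letI := Fintype.ofFinite n
  LinearMap.ker H.mulVecLin

/-- `C` recovers sequentially from `t` erasures with locality `r`, that is, `C` is an `(n, k, r, t)`
S-LR code: every set `S` of at most `t` erased symbols can be ordered in such a way that each of its
symbols is a linear combination of at most `r` symbols, none of which is the symbol itself or an
erased symbol that comes later in the order. -/
def IsSLR {ι F : Type*} [Field F] (C : Submodule F (ι → F)) (r t : ℕ) : Prop :=
  ∀ S : Finset ι, S.card ≤ t → ∃ σ : Fin S.card ≃ S, ∀ j, ∃ R : Finset ι, R.card ≤ r ∧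
    (∀ k, j ≤ k → (σ k : ι) ∉ R) ∧ ∃ u : ι → F, ∀ c ∈ C, c (σ j) = ∑ i ∈ R, u i * c i

/-- The rate `k / n` of a linear code. -/
noncomputable def codeRate {ι F : Type*} [Field F] (C : Submodule F (ι → F)) : ℚ :=
  (Module.finrank F C : ℚ) / (Nat.card ι : ℚ)

/-- The value of the rate bound for S-LR codes with parameters `r`, `t`, with
`s = ⌊(t - 1) / 2⌋`. -/
def rateBound (r t : ℕ) : ℚ :=
  if Even t then
    (r : ℚ) ^ ((t - 1) / 2 + 1) / ((r : ℚ) ^ ((t - 1) / 2 + 1) +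
      2 * ∑ i ∈ Finset.Icc 0 ((t - 1) / 2), (r : ℚ) ^ i)
  else
    (r : ℚ) ^ ((t - 1) / 2 + 1) / ((r : ℚ) ^ ((t - 1) / 2 + 1) +
      2 * ∑ i ∈ Finset.Icc 1 ((t - 1) / 2), (r : ℚ) ^ i + 1)

/-! Code symbols are edges and parity checks are nodes. A node with exactly one erased edge repairs
that edge from its at most `r` other edges, so sequential recovery is leaf peeling. If the girth
exceeds `t`, at most `t` erased edges form a forest, and a nonempty forest has a leaf other than the
root; this works over every field (`isSLR_parityCheckCode_of_le_girth`). Over `ZMod 2` the indicator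
of a cycle is a codeword, so a short cycle is an erasure pattern that cannot be repaired. The rate
follows by counting: the parity-check matrix is triangular with respect to the levels, and there are
`a₀ * r ^ i` edges between the levels `i` and `i + 1`.

A cycle in an expansion projects to a closed walk in the auxiliary graph. If this walk turned back,
the two edges would have the same colour, and properness of the colouring would make the cycle
itself turn back; hence the walk contains a cycle of the auxiliary graph, which is long. Cycles
through the root are long in every tree-like graph, and being tree-like survives expansion because
the projection is bijective on the edges at each node other than the root. Auxiliary graphs are
Cayley graphs generated by involutions of a set of reduced words. Coloured tree-like graphs are
built from words whose letters are the differences of the colours along a path from the root.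

For the upper bound, the rows of a basis of the span of the dual words of weight at most `r + 1` are
taken as vertices of a hypergraph, and the columns as its edges. Recovery forces any `k ≤ t` columns
to meet at least `k` rows (`IsSLR.card_le_card_biUnion`). This makes the hypergraph look like a tree
near the columns of weight one, and a discharging along breadth-first levels
(`card_le_of_discharging`) gives `n ≤ M * m` for `m` rows, where `1 - 1 / M` is the asserted rate.
The weights solve a linear recursion in which tree-like graphs are the case of equality; `r ≥ 3`
ensures that columns with three or more nonzero entries also receive enough. -/

namespace Graph

/-! ### Closed walks, cycles and girth -/

variable {α β : Type*}

/-- A closed walk, given as a piece of an infinite sequence, that does not turn back contains a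
cycle. -/
theorem exists_isCycle_of_walk (G : Graph α β) (x : ℕ → α) (e : ℕ → β) {i j : ℕ} (hij : i < j)
    (hx : x i = x j) (hl : ∀ a, i ≤ a → a < j → G.IsLink (e a) (x a) (x (a + 1)))
    (he : ∀ a, i ≤ a → a + 1 < j → e a ≠ e (a + 1)) :
    ∃ k y f, G.IsCycle k y f ∧ k + 1 ≤ j - i ∧ ∀ a, ∃ b, i ≤ b ∧ b < j ∧ f a = e b := by
  induction hn : j - i using Nat.strong_induction_on generalizing i j with
  | _ n ih =>
  by_cases h : ∃ a b, i ≤ a ∧ a < b ∧ b ≤ j ∧ b - a < j - i ∧ x a = x b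
  · obtain ⟨a, b, hia, hab, hbj, hlt, hxab⟩ := h
    obtain ⟨k, y, f, hc, hk, hf⟩ := ih (b - a) (by omega) hab hxab
      (fun c h1 h2 => hl c (by omega) (by omega)) (fun c h1 h2 => he c (by omega) (by omega)) rfl
    refine ⟨k, y, f, hc, by omega, fun c => ?_⟩
    obtain ⟨d, h1, h2, h3⟩ := hf c
    exact ⟨d, by omega, by omega, h3⟩
  · push Not at h
    have hinj : ∀ a b, i ≤ a → a < b → b < j → x a ≠ x b := fun a b h1 h2 h3 =>
      h a b h1 h2 (by omega) (by omega)
    obtain ⟨k, rfl⟩ : ∃ k, j = i + k + 1 := ⟨j - i - 1, by omega⟩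
    have hlink : ∀ a : Fin (k + 1),
        G.IsLink (e (i + a)) (x (i + a)) (x (i + (a + 1 : Fin (k + 1)))) := by
      intro a
      have h1 := hl (i + a) (by omega) (by omega)
      rw [Fin.val_add_one]
      split_ifs with h2
      · subst h2
        simpa [hx, add_assoc] using h1
      · simpa [add_assoc] using h1
    refine ⟨k, fun a => x (i + a), fun a => e (i + a), ⟨?_, ?_, hlink⟩, by omega,
      fun a => ⟨i + a, by omega, by omega, rfl⟩⟩
    · intro a b hab
      rcases lt_trichotomy a.val b.val with h1 | h1 | h1
      · exact (hinj _ _ (by omega) (by omega) (by omega) hab).elim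
      · exact Fin.ext h1
      · exact (hinj _ _ (by omega) (by omega) (by omega) hab.symm).elim
    · have key : ∀ a b : Fin (k + 1), a.val < b.val → e (i + a) ≠ e (i + b) := by
        intro a b hab h1
        have h2 := hl (i + a) (by omega) (by omega)
        have h3 := hl (i + b) (by omega) (by omega)
        rw [← h1] at h3
        -- As the vertices are distinct, an edge used twice is traversed in opposite directions in
        -- two consecutive steps, which `he` excludes.
        rcases h2.eq_and_eq_or_eq_and_eq h3 with ⟨h4, -⟩ | ⟨-, h4⟩
        · exact hinj _ _ (by omega) (by omega) (by omega) h4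
        · by_cases h5 : b.val = a.val + 1
          · refine he (i + a) (by omega) (by omega) ?_
            rw [h1, h5, add_assoc]
          · exact hinj (i + a + 1) (i + b) (by omega) (by omega) (by omega) h4
      intro a b hab
      rcases lt_trichotomy a.val b.val with h1 | h1 | h1
      · exact (key _ _ h1 hab).elim
      · exact Fin.ext h1
      · exact (key _ _ h1 hab.symm).elim

theorem IsCycle.girth_le {G : Graph α β} {k : ℕ} {x : Fin (k + 1) → α} {e : Fin (k + 1) → β}
    (h : G.IsCycle k x e) : G.girth ≤ ((k + 1 : ℕ) : ℕ∞) :=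
  iInf₂_le k ⟨x, e, h⟩

theorem le_girth_iff {G : Graph α β} {n : ℕ} :
    (n : ℕ∞) ≤ G.girth ↔ ∀ k x e, G.IsCycle k x e → n ≤ k + 1 := by
  refine ⟨fun h k x e hc => by exact_mod_cast h.trans hc.girth_le, fun h => ?_⟩
  refine le_iInf₂ fun k hk => ?_
  obtain ⟨x, e, hc⟩ := hk
  exact_mod_cast h k x e hc

/-- A cycle, read from its vertex `i` on, as a periodic walk. -/
theorem IsCycle.exists_walk {G : Graph α β} {k : ℕ} {x : Fin (k + 1) → α} {e : Fin (k + 1) → β}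
    (h : G.IsCycle k x e) (i : Fin (k + 1)) :
    ∃ (y : ℕ → α) (f : ℕ → β), y 0 = x i ∧ y (k + 1) = x i ∧
      (∀ n, G.IsLink (f n) (y n) (y (n + 1))) ∧
      (∀ n, ∃ m, y n = x m) ∧ (∀ n, ∃ m, f n = e m) ∧
      ∀ a b, a < b → b < k + 1 → f a ≠ f b := by
  have hofNat : ∀ n, Fin.ofNat (k + 1) (n + 1) = Fin.ofNat (k + 1) n + 1 := fun n => by
    ext
    simp [Fin.val_add]
  refine ⟨fun n => x (i + Fin.ofNat (k + 1) n), fun n => e (i + Fin.ofNat (k + 1) n), ?_, ?_,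
    fun n => ?_, fun n => ⟨_, rfl⟩, fun n => ⟨_, rfl⟩, fun a b hab hb hf => ?_⟩
  · simp
  · simp
  · have := h.isLink (i + Fin.ofNat (k + 1) n)
    rwa [add_assoc, ← hofNat] at this
  · have h1 := add_left_cancel (h.edge_injective hf)
    have h2 := congrArg Fin.val h1
    rw [Fin.val_ofNat, Fin.val_ofNat, Nat.mod_eq_of_lt (by omega), Nat.mod_eq_of_lt hb] at h2
    omega

/-- A finite nonempty set of edges in which no vertex, except possibly `v₀`, is a leaf contains a
cycle. -/
theorem exists_isCycle_of_no_leaf (G : Graph α β) (S : Finset β) (hS : S.Nonempty)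
    (hE : ∀ e ∈ S, e ∈ E(G)) (v₀ : α)
    (h : ∀ v, v ≠ v₀ → ∀ e ∈ S, G.Inc e v → ∃ f ∈ S, f ≠ e ∧ G.Inc f v) :
    ∃ k x e, G.IsCycle k x e ∧ k + 1 ≤ S.card ∧ ∀ i, e i ∈ S := by
  -- The walk may turn back only at `v₀`. It starts there if `S` meets `v₀`, so any return to `v₀`
  -- already closes the walk, and no turn occurs before the first repetition.
  obtain ⟨w, e₀, he₀, hw, hw'⟩ : ∃ w, ∃ e₀ ∈ S, G.Inc e₀ w ∧
      ((∃ e ∈ S, G.Inc e v₀) → w = v₀) := by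
    by_cases h0 : ∃ e ∈ S, G.Inc e v₀
    · obtain ⟨e, he, h1⟩ := h0
      exact ⟨v₀, e, he, h1, fun _ => rfl⟩
    · obtain ⟨e, he⟩ := hS
      obtain ⟨x, y, hxy⟩ := exists_isLink_of_mem_edgeSet (hE e he)
      exact ⟨x, e, he, hxy.inc_left, fun h => (h0 h).elim⟩
  -- A state of the walk is the edge that is about to be traversed, with its starting vertex.
  let St := {p : α × β // p.2 ∈ S ∧ G.Inc p.2 p.1}
  have step : ∀ p : St, ∃ q : St, G.IsLink p.1.2 p.1.1 q.1.1 ∧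
      (q.1.1 ≠ v₀ → q.1.2 ≠ p.1.2) := by
    rintro ⟨⟨v, e⟩, he, u, hu⟩
    by_cases hu0 : u = v₀
    · exact ⟨⟨(u, e), he, hu.inc_right⟩, hu, fun h => (h hu0).elim⟩
    · obtain ⟨f, hf, hfe, hfu⟩ := h u hu0 e he hu.inc_right
      exact ⟨⟨(u, f), hf, hfu⟩, hu, fun _ => hfe⟩
  choose next hnext hne using step
  let p : ℕ → St := fun n => Nat.rec ⟨(w, e₀), he₀, hw⟩ (fun _ q => next q) n
  have hp : ∀ n, p (n + 1) = next (p n) := fun n => rfl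
  let x : ℕ → α := fun n => (p n).1.1
  let e : ℕ → β := fun n => (p n).1.2
  have heS : ∀ n, e n ∈ S := fun n => (p n).2.1
  have hl : ∀ n, G.IsLink (e n) (x n) (x (n + 1)) := fun n => hnext (p n)
  have hex : ∃ j, ∃ i, i < j ∧ x i = x j := by
    let T : Finset α := S.attach.biUnion fun e =>
      {(exists_isLink_of_mem_edgeSet (hE e.1 e.2)).choose,
        (exists_isLink_of_mem_edgeSet (hE e.1 e.2)).choose_spec.choose}
    have hT : ∀ n, x n ∈ T := by
      intro n
      have h1 := (exists_isLink_of_mem_edgeSet (hE (e n) (heS n))).choose_spec.choose_spec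
      refine Finset.mem_biUnion.2 ⟨⟨e n, heS n⟩, Finset.mem_attach _ _, ?_⟩
      rcases (hl n).left_eq_or_eq h1 with h2 | h2
      · rw [h2]; exact Finset.mem_insert_self _ _
      · rw [h2]; exact Finset.mem_insert_of_mem (Finset.mem_singleton_self _)
    obtain ⟨a, b, hab, h1⟩ := Finite.exists_ne_map_eq_of_infinite
      (fun n => (⟨x n, hT n⟩ : T))
    have h2 : x a = x b := congrArg Subtype.val h1
    rcases lt_or_gt_of_ne hab with h3 | h3
    · exact ⟨b, a, h3, h2⟩
    · exact ⟨a, b, h3, h2.symm⟩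
  obtain ⟨i, hij, hx⟩ := Nat.find_spec hex
  set j := Nat.find hex with hj
  have hturn : ∀ a, i ≤ a → a + 1 < j → e a ≠ e (a + 1) := by
    intro a ha haj hee
    refine Nat.find_min hex haj ⟨0, by omega, ?_⟩
    by_contra hne0
    have h1 : x (a + 1) ≠ v₀ := fun h2 => hne0 <| by
      rw [h2]
      exact hw' ⟨e a, heS a, h2 ▸ (hl a).inc_right⟩
    exact hne (p a) h1 hee.symm
  obtain ⟨k, y, f, hc, hk, hf⟩ :=
    exists_isCycle_of_walk G x e hij hx (fun a _ _ => hl a) hturn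
  have hfS : ∀ a, f a ∈ S := fun a => by
    obtain ⟨b, -, -, h1⟩ := hf a
    exact h1 ▸ heS b
  refine ⟨k, y, f, hc, ?_, hfS⟩
  have := Finset.card_le_card_of_injOn (s := Finset.univ) (t := S) f (fun a _ => hfS a)
    hc.edge_injective.injOn
  simpa using this

end Graph

/-! ### Sequential recovery -/

section Code

variable {m n ι F : Type*} [Field F]

theorem mem_parityCheckCode [Fintype n] {H : Matrix m n F} {c : n → F} :
    c ∈ parityCheckCode H ↔ ∀ i, ∑ j, H i j * c j = 0 := by
  have key : c ∈ parityCheckCode H ↔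
      ∀ i, ∑ j ∈ @Finset.univ n (Fintype.ofFinite n), H i j * c j = 0 := by
    rw [parityCheckCode, LinearMap.mem_ker, funext_iff]
    rfl
  rw [key]
  congr!

/-- It suffices to find, in each small nonempty set of erased symbols, one symbol that is recovered
from a few non-erased ones. -/
theorem isSLR_of_forall_exists {C : Submodule F (ι → F)} {r t : ℕ}
    (h : ∀ T : Finset ι, T.Nonempty → T.card ≤ t → ∃ i ∈ T, ∃ R : Finset ι, R.card ≤ r ∧
      Disjoint R T ∧ ∃ u : ι → F, ∀ c ∈ C, c i = ∑ j ∈ R, u j * c j) : IsSLR C r t := by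
  intro S hS
  have key : ∀ (k : ℕ) (T : Finset ι), T.card = k → k ≤ t → ∃ f : Fin k → ι,
      Function.Injective f ∧ (∀ j, f j ∈ T) ∧ ∀ j, ∃ R : Finset ι, R.card ≤ r ∧
        (∀ k, j ≤ k → f k ∉ R) ∧ ∃ u : ι → F, ∀ c ∈ C, c (f j) = ∑ i ∈ R, u i * c i := by
    intro k
    induction k with
    | zero => exact fun T _ _ => ⟨Fin.elim0, fun a => a.elim0, fun a => a.elim0, fun a => a.elim0⟩
    | succ k ih =>
      intro T hT hk
      obtain ⟨i, hi, R, hR, hRT, u, hu⟩ := h T (Finset.card_pos.1 (by omega)) (by omega)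
      obtain ⟨f, hf, hfT, hfR⟩ := ih (T.erase i) (by rw [Finset.card_erase_of_mem hi]; omega)
        (by omega)
      refine ⟨Fin.cons i f, Fin.cons_injective_iff.2 ⟨?_, hf⟩, ?_, ?_⟩
      · rintro ⟨j, hj⟩
        exact Finset.ne_of_mem_erase (hfT j) hj
      · intro j
        refine Fin.cases hi (fun j => ?_) j
        exact Finset.mem_of_mem_erase (hfT j)
      · intro j
        refine Fin.cases ?_ (fun j => ?_) j
        · refine ⟨R, hR, fun k _ hk' => Finset.disjoint_left.1 hRT hk' ?_, u, hu⟩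
          refine Fin.cases hi (fun k => ?_) k
          exact Finset.mem_of_mem_erase (hfT k)
        · obtain ⟨R', h1, h2, h3⟩ := hfR j
          refine ⟨R', h1, fun k => ?_, h3⟩
          refine Fin.cases (fun h => ?_) (fun k h => ?_) k
          · exact absurd h (by simp)
          · exact h2 k (Fin.succ_le_succ_iff.1 h)
  obtain ⟨f, hf, hfS, hfR⟩ := key S.card S rfl hS
  refine ⟨Equiv.ofBijective (fun j => ⟨f j, hfS j⟩) ?_, hfR⟩
  rw [Fintype.bijective_iff_injective_and_card]
  exact ⟨fun a b hab => hf (congrArg Subtype.val hab), by simp⟩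

theorem IsSLR.exists_mem {C : Submodule F (ι → F)} {r t : ℕ} (h : IsSLR C r t) {T : Finset ι}
    (hT : T.Nonempty) (hTt : T.card ≤ t) : ∃ i ∈ T, ∃ R : Finset ι, R.card ≤ r ∧
      Disjoint R T ∧ ∃ u : ι → F, ∀ c ∈ C, c i = ∑ j ∈ R, u j * c j := by
  obtain ⟨σ, hσ⟩ := h T hTt
  obtain ⟨R, h1, h2, h3⟩ := hσ ⟨0, hT.card_pos⟩
  refine ⟨_, (σ ⟨0, hT.card_pos⟩).2, R, h1, Finset.disjoint_right.2 fun i hi => ?_, h3⟩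
  have := h2 (σ.symm ⟨i, hi⟩) (Nat.zero_le _)
  simpa using this

theorem finrank_parityCheckCode_add_card [Finite m] [Finite n] {H : Matrix m n F}
    (h : LinearIndependent F H.row) :
    Module.finrank F (parityCheckCode H) + Nat.card m = Nat.card n := by
  let _ := Fintype.ofFinite n
  let _ := Fintype.ofFinite m
  have h1 := H.mulVecLin.finrank_range_add_finrank_ker
  have h2 : Module.finrank F (LinearMap.range H.mulVecLin) = Fintype.card m := h.rank_matrix
  rw [Module.finrank_fintype_fun_eq_card, h2] at h1
  rw [Nat.card_eq_fintype_card, Nat.card_eq_fintype_card, ← h1, add_comm]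
  rfl

end Code

/-! ### Girth and recovery -/

namespace Graph

variable {α β F : Type*} [Field F]

/-- At most `t` erased edges contain no cycle, so some node `v ≠ root` is incident with exactly one
of them. The check at `v` then expresses this symbol by the others at `v`. Only the zero pattern of
`H` matters, and no row is needed at `root` because a finite forest with an edge has a second leaf.
-/
theorem isSLR_parityCheckCode_of_le_girth [Finite β] (G : Graph α β) (root : α) {r t : ℕ}
    (H : Matrix {v // v ∈ V(G) ∧ v ≠ root} E(G) F) (hH : ∀ v e, H v e ≠ 0 ↔ G.Inc e.1 v.1)
    (hdeg : ∀ v ∈ V(G), v ≠ root → G.deg v ≤ r + 1) (hg : ((t + 1 : ℕ) : ℕ∞) ≤ G.girth) :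
    IsSLR (parityCheckCode H) r t := by
  let _ := Fintype.ofFinite E(G)
  refine isSLR_of_forall_exists fun T hT hTt => ?_
  by_contra hcon
  have hleaf : ∀ v, v ≠ root → ∀ e ∈ T.map (Function.Embedding.subtype _), G.Inc e v →
      ∃ f ∈ T.map (Function.Embedding.subtype _), f ≠ e ∧ G.Inc f v := by
    intro v hv e he hev
    by_contra hf
    push Not at hf
    obtain ⟨e, heT, rfl⟩ := Finset.mem_map.1 he
    let w : {v // v ∈ V(G) ∧ v ≠ root} := ⟨v, hev.vertex_mem, hv⟩
    have hne : H w e ≠ 0 := (hH w e).2 hev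
    let Q : Finset E(G) := Finset.univ.filter fun f => G.Inc f.1 v
    have heQ : e ∈ Q := by simpa [Q] using hev
    refine hcon ⟨e, heT, Q.erase e, ?_, ?_, fun f => -(H w f / H w e), fun c hc => ?_⟩
    · have h1 : Q.card ≤ G.deg v := by
        rw [deg, ← Finset.card_map (Function.Embedding.subtype _), ← Set.ncard_coe_finset]
        refine Set.ncard_le_ncard ?_
        intro f
        simp +contextual [Q]
      have := hdeg v hev.vertex_mem hv
      rw [Finset.card_erase_of_mem heQ]
      omega
    · rw [Finset.disjoint_right]
      intro f hf' hfQ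
      rw [Finset.mem_erase, Finset.mem_filter] at hfQ
      refine hf f.1 (Finset.mem_map_of_mem _ hf') (fun h => hfQ.1 (Subtype.ext h)) hfQ.2.2
    · have h1 := mem_parityCheckCode.1 hc w
      have h2 : ∑ j ∈ Q, H w j * c j = 0 := by
        rw [← h1]
        refine Finset.sum_subset (Finset.subset_univ _) fun f _ hfQ => ?_
        have : H w f = 0 := by
          by_contra h3
          exact hfQ (by simpa [Q] using (hH w f).1 h3)
        rw [this, zero_mul]
      rw [← Finset.add_sum_erase _ _ heQ] at h2
      have h3 : c e = -(∑ j ∈ Q.erase e, H w j * c j) / H w e := by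
        rw [eq_div_iff hne]
        linear_combination h2
      rw [h3, neg_div, Finset.sum_div, ← Finset.sum_neg_distrib]
      refine Finset.sum_congr rfl fun j _ => ?_
      ring
  obtain ⟨k, x, e, hc, hk, -⟩ := exists_isCycle_of_no_leaf G (T.map (Function.Embedding.subtype _))
    hT.map (by simp +contextual) root hleaf
  have := le_girth_iff.1 hg k x e hc
  rw [Finset.card_map] at hk
  omega

theorem IsLink.inc_iff {G : Graph α β} {e : β} {x y v : α} (h : G.IsLink e x y) :
    G.Inc e v ↔ v = x ∨ v = y :=
  ⟨fun hv => hv.eq_or_eq_of_isLink h, by rintro (rfl | rfl); exacts [h.inc_left, h.inc_right]⟩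

/-- The indicator `c` of a cycle is a codeword over `ZMod 2`, since each node of the cycle lies on
two of its edges. If the whole cycle is erased, the first recovered symbol is a combination of
symbols at which `c` vanishes, although `c` equals `1` there. -/
theorem le_girth_of_isSLR_incidenceMatrix [Finite α] [Finite β] (G : Graph α β) [G.Loopless]
    {r t : ℕ} (h : IsSLR (parityCheckCode G.incidenceMatrix) r t) :
    ((t + 1 : ℕ) : ℕ∞) ≤ G.girth := by
  let _ := Fintype.ofFinite E(G)
  refine le_girth_iff.2 fun k x e hc => ?_
  by_contra hk
  let e' : Fin (k + 1) ↪ E(G) := ⟨fun i => ⟨e i, (hc.isLink i).edge_mem⟩,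
    fun i j hij => hc.edge_injective (congrArg Subtype.val hij)⟩
  let S : Finset E(G) := Finset.univ.map e'
  obtain ⟨f, hf, R, -, hR, u, hu⟩ := h.exists_mem (T := S) (by simp [S]) (by simp [S]; omega)
  let c : E(G) → ZMod 2 := fun f => if f ∈ S then 1 else 0
  have hcC : c ∈ parityCheckCode G.incidenceMatrix := by
    rw [mem_parityCheckCode]
    rintro ⟨v, hv⟩
    simp only [c, mul_ite, mul_one, mul_zero, Finset.sum_ite_mem, Finset.univ_inter]
    rw [Finset.sum_map]
    let g : Fin (k + 1) → ZMod 2 := fun i => if x i = v then 1 else 0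
    have h1 : ∀ i, G.incidenceMatrix ⟨v, hv⟩ (e' i) = g i + g (i + 1) := by
      intro i
      have h2 := hc.isLink i
      have h3 := h2.ne
      have h4 : G.Inc (e' i).1 v ↔ v = x i ∨ v = x (i + 1) := h2.inc_iff
      simp only [incidenceMatrix, h4, g]
      by_cases h5 : v = x i
      · subst h5
        simp [h3.symm]
      · simp only [h5, Ne.symm h5, false_or, if_false, zero_add, @eq_comm _ v]
    simp only [h1]
    have h2 : ∑ i, g (i + 1) = ∑ i, g i := Equiv.sum_comp (Equiv.addRight 1) g
    rw [Finset.sum_add_distrib, h2]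
    exact CharTwo.add_self_eq_zero _
  have h1 := hu c hcC
  have h2 : ∑ j ∈ R, u j * c j = 0 :=
    Finset.sum_eq_zero fun j hj => by simp [c, Finset.disjoint_left.1 hR hj]
  rw [h2] at h1
  simp [c, hf] at h1

/-- One row of the binary incidence matrix is redundant. -/
theorem parityCheckCode_incidenceMatrix [Finite α] [Finite β] (G : Graph α β) [G.Loopless]
    (root : α) :
    parityCheckCode G.incidenceMatrix = parityCheckCode (G.incidenceMatrix.submatrix
      (fun v : {v // v ∈ V(G) ∧ v ≠ root} => ⟨v.1, v.2.1⟩) id) := by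
  let _ := Fintype.ofFinite E(G)
  let _ := Fintype.ofFinite V(G)
  ext c
  rw [mem_parityCheckCode, mem_parityCheckCode]
  refine ⟨fun h v => h ⟨v.1, v.2.1⟩, fun h => ?_⟩
  have h0 : ∀ v : V(G), v.1 ≠ root → ∑ e, G.incidenceMatrix v e * c e = 0 :=
    fun v hv => h ⟨v.1, v.2, hv⟩
  intro v
  by_cases hv : v.1 = root
  swap
  · exact h0 v hv
  -- Every column has two ones, so the rows add up to zero and the row of the root is minus the sum
  -- of the others.
  have h1 : ∑ w : V(G), ∑ e, G.incidenceMatrix w e * c e = 0 := by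
    rw [Finset.sum_comm]
    refine Finset.sum_eq_zero fun e _ => ?_
    rw [← Finset.sum_mul]
    obtain ⟨x, y, hxy⟩ := exists_isLink_of_mem_edgeSet e.2
    have h2 : ∀ w : V(G), G.incidenceMatrix w e =
        (if w = ⟨x, hxy.left_mem⟩ then 1 else 0) + (if w = ⟨y, hxy.right_mem⟩ then 1 else 0) := by
      rintro ⟨w, hw⟩
      simp only [incidenceMatrix, hxy.inc_iff, Subtype.mk.injEq]
      by_cases h3 : w = x
      · subst h3
        simp [hxy.ne]
      · simp [h3]
    simp only [h2, Finset.sum_add_distrib, Finset.sum_ite_eq', Finset.mem_univ, if_true]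
    rw [CharTwo.add_self_eq_zero, zero_mul]
  rwa [Finset.sum_eq_single v (fun w _ hw => h0 w fun hwr => hw (Subtype.ext (hwr.trans hv.symm)))
    (by simp)] at h1

end Graph

/-! ### Tree-like graphs: rank and rate -/

namespace Graph

variable {α β F : Type*} [Field F]

namespace IsTreeLike

variable {G : Graph α β} {r t a₀ : ℕ} {root : α} {lev : α → ℕ}

theorem loopless (h : G.IsTreeLike r t a₀ root lev) : G.Loopless :=
  ⟨fun e x hx => by
    rcases h.isLink (isLink_self_iff.2 hx) with h1 | h1 | h1
    · omega
    · omega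
    · exact h1.2.2.2 rfl⟩

theorem exists_down (h : G.IsTreeLike r t a₀ root lev) {v : α} (hv : v ∈ V(G)) (hvr : v ≠ root) :
    ∃ e u, G.IsLink e v u ∧ lev u < lev v := by
  by_cases h1 : Odd t → lev v ≤ (t - 1) / 2
  · exact (h.existsUnique_down v hv hvr h1).exists
  · push Not at h1
    have h2 : {e | G.Inc e v}.Nonempty := by
      refine Set.nonempty_of_ncard_ne_zero ?_
      have := h.deg_eq v hv hvr
      rw [deg] at this
      omega
    obtain ⟨e, u, hu⟩ := h2
    refine ⟨e, u, hu, ?_⟩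
    have h3 := h.lev_le u hu.right_mem
    rcases h.isLink hu with h4 | h4 | h4
    · omega
    · omega
    · exact absurd h4.1 (Nat.not_even_iff_odd.2 h1.1)

/-- The matrix is a staircase: each node has an edge to a lower level, and the column of this edge
has only one other entry, in a row whose coefficient already vanishes by induction, or at `root`,
which has no row. -/
theorem linearIndependent_row [Finite α] (h : G.IsTreeLike r t a₀ root lev)
    (H : Matrix {v // v ∈ V(G) ∧ v ≠ root} E(G) F) (hH : ∀ v e, H v e ≠ 0 ↔ G.Inc e.1 v.1) :
    LinearIndependent F H.row := by
  let _ := Fintype.ofFinite {v // v ∈ V(G) ∧ v ≠ root}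
  rw [Fintype.linearIndependent_iff]
  intro g hg
  have key : ∀ (k : ℕ) v, lev v.1 = k → g v = 0 := by
    intro k
    induction k using Nat.strong_induction_on with
    | _ k ih =>
    intro v hvk
    obtain ⟨e, u, he, hu⟩ := h.exists_down v.2.1 v.2.2
    have h1 := congrFun hg ⟨e, he.edge_mem⟩
    rw [Finset.sum_apply, Finset.sum_eq_single v, Pi.smul_apply, smul_eq_mul, Pi.zero_apply,
      mul_eq_zero] at h1
    · exact h1.resolve_right ((hH v ⟨e, he.edge_mem⟩).2 he.inc_left)
    · intro w _ hw
      rw [Pi.smul_apply, smul_eq_mul, mul_eq_zero]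
      by_contra h2
      push Not at h2
      rcases ((hH w ⟨e, he.edge_mem⟩).1 h2.2).eq_or_eq_of_isLink he with h3 | h3
      · exact hw (Subtype.ext h3)
      · exact h2.1 (ih (lev w.1) (by rw [h3]; omega) w rfl)
    · simp
  exact fun v => key _ v rfl

/-- The size of a tree-like graph. Here `D i` is the number of edges between the levels `i` and
`i + 1`, `W` the number of edges within the last level and `N` the number of vertices there. -/
theorem exists_card [Finite α] [Finite β] (h : G.IsTreeLike r t a₀ root lev) :
    ∃ (D : ℕ → ℕ) (W N : ℕ), (∀ i ≤ (t - 1) / 2, D i = a₀ * r ^ i) ∧ (Odd t → W = 0) ∧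
      Nat.card E(G) = ∑ i ∈ Finset.range ((t - 1) / 2 + 1), D i + W ∧
      Nat.card {v // v ∈ V(G) ∧ v ≠ root} = ∑ i ∈ Finset.range ((t - 1) / 2), D i + N ∧
      (r + 1) * N = D ((t - 1) / 2) + 2 * W ∧ (Even t → N = D ((t - 1) / 2)) := by
  have hll := h.loopless
  have hlev := h.lev_le
  have hlk := h.isLink
  have hdown := h.existsUnique_down
  set s := (t - 1) / 2 with hs
  let _ := Fintype.ofFinite E(G)
  let _ := Fintype.ofFinite {v // v ∈ V(G) ∧ v ≠ root}
  have hends : ∀ e : E(G), ∃ p q, G.IsLink e.1 p q ∧ lev p ≤ lev q := by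
    intro e
    obtain ⟨x, y, hxy⟩ := exists_isLink_of_mem_edgeSet e.2
    rcases le_total (lev x) (lev y) with h1 | h1
    · exact ⟨x, y, hxy, h1⟩
    · exact ⟨y, x, hxy.symm, h1⟩
  choose p q hpq hle using hends
  have hcl : ∀ e, lev (q e) = lev (p e) + 1 ∧ lev (p e) ≤ s ∨
      Even t ∧ lev (p e) = s + 1 ∧ lev (q e) = s + 1 := by
    intro e
    have h1 := hle e
    have h2 := hlev _ (hpq e).right_mem
    rcases hlk (hpq e) with h3 | h3 | h3
    · exact Or.inl ⟨h3, by omega⟩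
    · omega
    · exact Or.inr ⟨h3.1, h3.2.1, h3.2.2.1⟩
  have hp0 : ∀ e, lev (p e) = 0 ↔ p e = root := fun e => h.lev_eq_zero _ (hpq e).left_mem
  have hq0 : ∀ e, q e ≠ root := by
    intro e h1
    have := (h.lev_eq_zero _ (hpq e).right_mem).2 h1
    have := hcl e
    omega
  have hdeg : ∀ v, G.deg v = (Finset.univ.filter fun e => p e = v).card +
      (Finset.univ.filter fun e => q e = v).card := by
    intro v
    rw [← Finset.card_union_of_disjoint, ← Finset.card_map (Function.Embedding.subtype _),
      ← Set.ncard_coe_finset, deg]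
    · congr 1
      ext e
      constructor
      · intro he
        refine Finset.mem_coe.2 (Finset.mem_map.2 ⟨⟨e, Inc.edge_mem he⟩, ?_, rfl⟩)
        have := (hpq ⟨e, Inc.edge_mem he⟩).inc_iff.1 he
        simpa [eq_comm] using this
      · intro he
        obtain ⟨f, hf, rfl⟩ := Finset.mem_map.1 (Finset.mem_coe.1 he)
        refine (hpq f).inc_iff.2 ?_
        simpa [eq_comm] using hf
    · rw [Finset.disjoint_left]
      intro e he hf
      rw [Finset.mem_filter] at he hf
      exact (hpq e).ne (he.2.trans hf.2.symm)
  let D : ℕ → ℕ := fun i => (Finset.univ.filter fun e => lev (p e) = i ∧ lev (q e) = i + 1).card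
  let W : ℕ := (Finset.univ.filter fun e => lev (p e) = s + 1 ∧ lev (q e) = s + 1).card
  let N : ℕ → ℕ := fun i =>
    (Finset.univ.filter fun v : {v // v ∈ V(G) ∧ v ≠ root} => lev v.1 = i).card
  -- The number of edges whose lower, or upper, end is at level `i ≥ 1`.
  have hfib : ∀ (z : E(G) → α), (∀ e, z e ∈ V(G)) → ∀ i, i ≠ 0 →
      ∑ v : {v // v ∈ V(G) ∧ v ≠ root} with lev v.1 = i,
        (Finset.univ.filter fun e => z e = v.1).card =
      (Finset.univ.filter fun e => lev (z e) = i).card := by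
    intro z hz i hi
    have hzr : ∀ e, lev (z e) = i → z e ≠ root := by
      intro e he h1
      exact hi (he ▸ (h.lev_eq_zero _ (hz e)).2 h1)
    rw [← Finset.card_biUnion]
    · congr 1
      ext e
      simp only [Finset.mem_biUnion, Finset.mem_filter, Finset.mem_univ, true_and]
      constructor
      · rintro ⟨v, h1, h2⟩
        rw [h2, h1]
      · intro h1
        exact ⟨⟨z e, hz e, hzr e h1⟩, h1, rfl⟩
    · intro v _ w _ hvw
      rw [Function.onFun, Finset.disjoint_left]
      intro e he hf
      rw [Finset.mem_filter] at he hf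
      exact hvw (Subtype.ext (he.2.symm.trans hf.2))
  have hsum : ∀ i, i ≠ 0 → (r + 1) * N i = (Finset.univ.filter fun e => lev (p e) = i).card +
      (Finset.univ.filter fun e => lev (q e) = i).card := by
    intro i hi
    rw [← hfib p (fun e => (hpq e).left_mem) i hi, ← hfib q (fun e => (hpq e).right_mem) i hi,
      ← Finset.sum_add_distrib, mul_comm]
    simp only [← hdeg]
    rw [Finset.sum_congr rfl fun v _ => h.deg_eq v.1 v.2.1 v.2.2, Finset.sum_const, smul_eq_mul]
  have hP : ∀ i ≤ s, (Finset.univ.filter fun e => lev (p e) = i).card = D i := by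
    intro i hi
    congr 1
    ext e
    have := hcl e
    simp only [Finset.mem_filter, Finset.mem_univ, true_and]
    omega
  have hPs : (Finset.univ.filter fun e => lev (p e) = s + 1).card = W := by
    congr 1
    ext e
    have := hcl e
    simp only [Finset.mem_filter, Finset.mem_univ, true_and]
    omega
  have hQ : ∀ i < s, (Finset.univ.filter fun e => lev (q e) = i + 1).card = D i := by
    intro i hi
    congr 1
    ext e
    have := hcl e
    simp only [Finset.mem_filter, Finset.mem_univ, true_and]
    omega
  have hQs : (Finset.univ.filter fun e => lev (q e) = s + 1).card = D s + W := by
    rw [← Finset.card_union_of_disjoint]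
    · congr 1
      ext e
      have := hcl e
      simp only [Finset.mem_filter, Finset.mem_univ, true_and, Finset.mem_union]
      omega
    · rw [Finset.disjoint_left]
      intro e he hf
      rw [Finset.mem_filter] at he hf
      omega
  have hD0 : D 0 = a₀ := by
    rw [← h.deg_root, hdeg, ← hP 0 (Nat.zero_le _)]
    simp [hp0, hq0]
  -- Mapping an edge to its higher end is a bijection, as each of these vertices has exactly one
  -- edge down.
  have hN : ∀ i ≤ s, (Odd t → i < s) → N (i + 1) = D i := by
    intro i hi hodd
    symm
    refine Finset.card_bij (fun e _ => ⟨q e, (hpq e).right_mem, hq0 e⟩) ?_ ?_ ?_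
    · intro e he
      rw [Finset.mem_filter] at he ⊢
      exact ⟨Finset.mem_univ _, he.2.2⟩
    · intro e he f hf hef
      rw [Finset.mem_filter] at he hf
      have h1 : q e = q f := congrArg Subtype.val hef
      refine Subtype.ext ((hdown (q e) (hpq e).right_mem (hq0 e) (fun ho => ?_)).unique
        ⟨p e, (hpq e).symm, by omega⟩ ⟨p f, h1 ▸ (hpq f).symm, by rw [h1]; omega⟩)
      have := hodd ho
      omega
    · rintro ⟨v, hv, hvr⟩ hvi
      rw [Finset.mem_filter] at hvi
      have hvi' : lev v = i + 1 := hvi.2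
      obtain ⟨e, ⟨u, he, hu⟩, -⟩ := hdown v hv hvr (fun ho => by have := hodd ho; omega)
      refine ⟨⟨e, he.edge_mem⟩, ?_, ?_⟩
      all_goals
        have h1 := hcl ⟨e, he.edge_mem⟩
        have h2 := hlk he
        rcases he.eq_and_eq_or_eq_and_eq (hpq ⟨e, he.edge_mem⟩) with ⟨h3, h4⟩ | ⟨h3, h4⟩
      · have := hle ⟨e, he.edge_mem⟩
        rw [← h3, ← h4] at this
        omega
      · rw [Finset.mem_filter, ← h3, ← h4]
        exact ⟨Finset.mem_univ _, by omega, by omega⟩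
      · have := hle ⟨e, he.edge_mem⟩
        rw [← h3, ← h4] at this
        omega
      · exact Subtype.ext h3.symm
  -- One of the `r + 1` edges at a vertex leads down, so `r` lead up.
  have hDi : ∀ i ≤ s, D i = a₀ * r ^ i := by
    intro i
    induction i with
    | zero => intro _; rw [hD0, pow_zero, mul_one]
    | succ i ih =>
      intro hi
      have h1 := hsum (i + 1) (Nat.succ_ne_zero i)
      rw [hP (i + 1) hi, hQ i (by omega), hN i (by omega) (fun _ => by omega)] at h1
      have h2 := ih (by omega)
      rw [pow_succ, ← mul_assoc, ← h2]
      linarith [mul_comm r (D i)]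
  refine ⟨D, W, N (s + 1), hDi, ?_, ?_, ?_, ?_, ?_⟩
  · intro ho
    rw [Finset.card_eq_zero, Finset.filter_eq_empty_iff]
    intro e _ he
    have := hcl e
    rcases this with h1 | h1
    · omega
    · exact absurd h1.1 (Nat.not_even_iff_odd.2 ho)
  · rw [Nat.card_eq_fintype_card, ← Finset.card_univ,
      Finset.card_eq_sum_card_fiberwise (f := fun e => lev (p e)) (t := Finset.range (s + 2)),
      Finset.sum_range_succ, hPs]
    · congr 1
      exact Finset.sum_congr rfl fun i hi => hP i (by rw [Finset.mem_range] at hi; omega)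
    · intro e _
      have := hcl e
      simp only [Finset.coe_range, Set.mem_Iio]
      omega
  · rw [Nat.card_eq_fintype_card, ← Finset.card_univ,
      Finset.card_eq_sum_card_fiberwise (f := fun v => lev v.1) (t := Finset.range (s + 2)),
      Finset.sum_range_succ, Finset.sum_range_succ']
    · have h0 : (Finset.univ.filter
          fun v : {v // v ∈ V(G) ∧ v ≠ root} => lev v.1 = 0).card = 0 := by
        rw [Finset.card_eq_zero, Finset.filter_eq_empty_iff]
        intro v _ hv
        exact v.2.2 ((h.lev_eq_zero _ v.2.1).1 hv)
      rw [h0, add_zero]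
      congr 1
      refine Finset.sum_congr rfl fun i hi => hN i ?_ ?_ <;> rw [Finset.mem_range] at hi
      · omega
      · exact fun _ => hi
    · intro v _
      have := hlev v.1 v.2.1
      simp only [Finset.coe_range, Set.mem_Iio]
      omega
  · rw [hsum (s + 1) (Nat.succ_ne_zero s), hPs, hQs]
    ring
  · intro he
    exact hN s le_rfl fun ho => absurd he (Nat.not_even_iff_odd.2 ho)

/-- The checks are independent, so the dimension is the number of edges minus the number of nodes
other than `root`. For even `t` each such node is paired with its edge down, and the dimension is
the number `W` of edges within the last level. For odd `t` the last level has `D s / (r + 1)` nodes,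
and the geometric sum turns the denominator of `rateBound` into `(r + 1) * P`. -/
theorem codeRate_eq [Finite α] [Finite β] (h : G.IsTreeLike r t a₀ root lev) (hr : 1 ≤ r)
    (ha : 0 < a₀) (H : Matrix {v // v ∈ V(G) ∧ v ≠ root} E(G) F)
    (hH : ∀ v e, H v e ≠ 0 ↔ G.Inc e.1 v.1) :
    codeRate (parityCheckCode H) = rateBound r t := by
  have hrank := finrank_parityCheckCode_add_card (h.linearIndependent_row H hH)
  obtain ⟨D, W, N, hD, hW, hE, hV, hN, hN'⟩ := h.exists_card
  rw [codeRate, rateBound]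
  set s := (t - 1) / 2
  rw [hV] at hrank
  have hDsum : ∑ i ∈ Finset.range (s + 1), D i = a₀ * ∑ i ∈ Finset.range (s + 1), r ^ i := by
    rw [Finset.mul_sum]
    exact Finset.sum_congr rfl fun i hi => hD i (by rw [Finset.mem_range] at hi; omega)
  have hDs := hD s le_rfl
  rw [Finset.sum_range_succ] at hDsum
  rw [Finset.sum_range_succ] at hE
  have hrank' : (Module.finrank F (parityCheckCode H) : ℚ) +
      ((∑ i ∈ Finset.range s, D i : ℕ) + N) = Nat.card E(G) := by exact_mod_cast hrank
  have hE' : (Nat.card E(G) : ℚ) = (∑ i ∈ Finset.range s, D i : ℕ) + D s + W := by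
    rw [hE]; push_cast; ring
  have hDsum' : ((∑ i ∈ Finset.range s, D i : ℕ) : ℚ) + D s =
      a₀ * ∑ i ∈ Finset.range (s + 1), (r : ℚ) ^ i := by exact_mod_cast hDsum
  have hDs' : (D s : ℚ) = a₀ * (r : ℚ) ^ s := by exact_mod_cast hDs
  have hNq : ((r : ℚ) + 1) * N = D s + 2 * W := by exact_mod_cast hN
  have ha' : (0 : ℚ) < a₀ := by exact_mod_cast ha
  have hr' : (0 : ℚ) < r := by exact_mod_cast hr
  have hpos : (0 : ℚ) < ∑ i ∈ Finset.range (s + 1), (r : ℚ) ^ i :=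
    Finset.sum_pos (fun i _ => by positivity) (by simp)
  have hpow : (r : ℚ) ^ (s + 1) = r * (r : ℚ) ^ s := pow_succ' _ _
  have hps : (0 : ℚ) < (r : ℚ) ^ s := by positivity
  set P := ∑ i ∈ Finset.range (s + 1), (r : ℚ) ^ i with hPdef
  set X : ℚ := ((∑ i ∈ Finset.range s, D i : ℕ) : ℚ)
  split_ifs with het
  · have hI : ∑ i ∈ Finset.Icc 0 s, (r : ℚ) ^ i = P := by
      rw [hPdef, Finset.range_eq_Ico]
      rfl
    have hNe : (N : ℚ) = D s := by exact_mod_cast hN' het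
    rw [hI]
    have hWq : 2 * (W : ℚ) = a₀ * (r : ℚ) ^ (s + 1) := by
      rw [hpow]
      linear_combination (r : ℚ) * hDs' - hNq + ((r : ℚ) + 1) * hNe
    have hk : (Module.finrank F (parityCheckCode H) : ℚ) = W := by linarith
    have hEq : 2 * (Nat.card E(G) : ℚ) = a₀ * ((r : ℚ) ^ (s + 1) + 2 * P) := by
      linear_combination 2 * hE' + 2 * hDsum' + hWq
    have h1 : (0 : ℚ) < (r : ℚ) ^ (s + 1) + 2 * P := by positivity
    have h2 : (0 : ℚ) < Nat.card E(G) := by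
      have : (0 : ℚ) < a₀ * ((r : ℚ) ^ (s + 1) + 2 * P) := by positivity
      linarith
    rw [hk, div_eq_div_iff h2.ne' h1.ne']
    linear_combination (1 / 2 * ((r : ℚ) ^ (s + 1) + 2 * P)) * hWq - (r : ℚ) ^ (s + 1) / 2 * hEq
  · have hW0 : (W : ℚ) = 0 := by exact_mod_cast hW (Nat.not_even_iff_odd.1 het)
    have hI : P = ∑ i ∈ Finset.Icc 1 s, (r : ℚ) ^ i + 1 := by
      rw [hPdef, Finset.sum_range_succ', pow_zero, Finset.range_eq_Ico,
        Finset.sum_Ico_add' (fun i => (r : ℚ) ^ i)]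
      rfl
    have hgeo : (r : ℚ) * P + 1 = P + (r : ℚ) ^ (s + 1) := by
      rw [hPdef, ← geom_sum_succ, Finset.sum_range_succ]
    have hden : (r : ℚ) ^ (s + 1) + 2 * ∑ i ∈ Finset.Icc 1 s, (r : ℚ) ^ i + 1 =
        ((r : ℚ) + 1) * P := by linear_combination -hgeo - 2 * hI
    rw [hden]
    have hk : ((r : ℚ) + 1) * (Module.finrank F (parityCheckCode H) : ℚ) =
        a₀ * (r : ℚ) ^ (s + 1) := by
      rw [hpow]
      linear_combination ((r : ℚ) + 1) * hrank' + ((r : ℚ) + 1) * hE' - hNq + r * hDs' +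
        ((r : ℚ) - 1) * hW0
    have hEq : (Nat.card E(G) : ℚ) = a₀ * P := by
      linear_combination hE' + hDsum' + hW0
    have h2 : (0 : ℚ) < a₀ * P := by positivity
    rw [hEq, div_eq_div_iff h2.ne' (by positivity)]
    linear_combination P * hk

end IsTreeLike

theorem incidenceMatrix_submatrix_ne_zero_iff (G : Graph α β) (root : α)
    (v : {v // v ∈ V(G) ∧ v ≠ root}) (e : E(G)) :
    G.incidenceMatrix.submatrix (fun v : {v // v ∈ V(G) ∧ v ≠ root} => (⟨v.1, v.2.1⟩ : V(G))) id
      v e ≠ 0 ↔ G.Inc e.1 v.1 := by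
  simp [incidenceMatrix]

/-- The girth criterion for binary codes. -/
theorem IsTreeLike.incidenceMatrix_code [Finite α] [Finite β] {G : Graph α β} {r t a₀ : ℕ}
    {root : α} {lev : α → ℕ} (h : G.IsTreeLike r t a₀ root lev) (hr : 1 ≤ r) :
    (IsSLR (parityCheckCode G.incidenceMatrix) r t ↔ ((t + 1 : ℕ) : ℕ∞) ≤ G.girth) ∧
      (0 < a₀ → codeRate (parityCheckCode G.incidenceMatrix) = rateBound r t) := by
  have := h.loopless
  refine ⟨⟨le_girth_of_isSLR_incidenceMatrix G, fun hg => ?_⟩, fun ha => ?_⟩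
  · rw [parityCheckCode_incidenceMatrix G root]
    exact isSLR_parityCheckCode_of_le_girth G root _
      (incidenceMatrix_submatrix_ne_zero_iff G root) (fun v hv hvr => (h.deg_eq v hv hvr).le) hg
  · rw [parityCheckCode_incidenceMatrix G root]
    exact h.codeRate_eq hr ha _ (incidenceMatrix_submatrix_ne_zero_iff G root)

end Graph

/-! ### Expansion by an auxiliary graph -/

namespace Graph

variable {α β γ δ ι : Type*}

/-- The projection of a cycle to `A` does not turn back: if two consecutive edges lie over the same
edge of `A`, they have the same colour, hence by properness lie over the same edge of `B`, and then
they coincide. -/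
theorem le_girth_expand {n : ℕ} {B : Graph α β} {A : Graph γ δ} {cB : β → ι} {cA : δ → Option ι}
    (hB : B.IsProperEdgeColouring cB) (hA : (n : ℕ∞) ≤ A.girth) :
    (n : ℕ∞) ≤ (B.expand A cB cA).girth := by
  rw [le_girth_iff] at hA ⊢
  intro k x e hc
  obtain ⟨y, f, hy0, hyk, hl, -, -, hne⟩ := hc.exists_walk 0
  obtain ⟨k', y', f', hc', hk, -⟩ := exists_isCycle_of_walk A (fun n => (y n).2)
    (fun n => (f n).2.1) (Nat.succ_pos k) (congrArg Prod.snd (hy0.trans hyk.symm))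
    (fun a _ _ => (hl a).2.1) (fun a _ ha h => by
      obtain ⟨h1, h2, h3, h4⟩ := hl a
      obtain ⟨h1', h2', h3', h4'⟩ := hl (a + 1)
      have h5 : (f a).1 = (f (a + 1)).1 := by
        refine hB h1.inc_right h1'.inc_left (Option.some_injective _ ?_)
        rw [← h3, ← h3', h]
      rw [← h5] at h1'
      rw [← h] at h2'
      have h6 : y (a + 1 + 1) = y a :=
        Prod.ext (h1'.right_unique h1.symm) (h2'.right_unique h2.symm)
      refine hne a (a + 1) (Nat.lt_succ_self a) ha (Prod.ext h5 (Prod.ext h ?_))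
      rw [h4, h4', h6, Sym2.eq_swap])
  have := hA k' y' f' hc'
  omega

theorem base_isLink {G : Graph α β} {root : α} {e : β} {x y : α} :
    (G.base root).IsLink e x y ↔ G.IsLink e x y ∧ x ≠ root ∧ y ≠ root := by
  simp [base]

namespace IsTreeLike

variable {G : Graph α β} {r t a₀ : ℕ} {root : α} {lev : α → ℕ}

/-- Every cycle through the root has length at least `t + 1`. -/
theorem lt_of_isCycle (h : G.IsTreeLike r t a₀ root lev) {k : ℕ} {x : Fin (k + 1) → α}
    {e : Fin (k + 1) → β} (hc : G.IsCycle k x e) {i : Fin (k + 1)} (hi : x i = root) :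
    t + 1 ≤ k + 1 := by
  obtain ⟨y, f, hy0, hyk, hl, -, -, hne⟩ := hc.exists_walk i
  have hlev0 : lev root = 0 := (h.lev_eq_zero _ h.root_mem).2 rfl
  have hl0 : lev (y 0) = 0 := by rw [hy0, hi, hlev0]
  have hlk : lev (y (k + 1)) = 0 := by rw [hyk, hi, hlev0]
  have hle := fun n => h.lev_le _ (hl n).left_mem
  have hnr : ∀ n, lev (y n) ≠ 0 → y n ≠ root := fun n hn h1 => hn (by rw [h1, hlev0])
  have hisLink := h.isLink
  have hdown := h.existsUnique_down
  set s := (t - 1) / 2 with hs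
  -- A walk that entered a vertex from below does not leave it downwards.
  have hturn : ∀ n, n + 1 < k + 1 → lev (y n) < lev (y (n + 1)) →
      lev (y (n + 2)) < lev (y (n + 1)) → (Odd t → lev (y (n + 1)) ≤ s) → False := by
    intro n hn h1 h2 h3
    refine hne n (n + 1) (Nat.lt_succ_self n) hn ?_
    exact (hdown _ (hl n).right_mem (hnr _ (by omega)) h3).unique ⟨_, (hl n).symm, h1⟩
      ⟨_, hl (n + 1), h2⟩
  -- Starting at the root, the walk has to climb straight to level `s + 1`. Descending again takes
  -- at least `s + 1` steps, which suffices for `t = 2 * s + 1`.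
  have hup : ∀ n, n ≤ s + 1 → n ≤ k + 1 → lev (y n) = n := by
    intro n
    induction n using Nat.strong_induction_on with
    | _ n ih =>
      intro h1 h2
      obtain _ | _ | n := n
      · exact hl0
      · have := hisLink (hl 0)
        rw [zero_add] at this ⊢
        omega
      · have h3 := ih n (by omega) (by omega) (by omega)
        have h4 := ih (n + 1) (by omega) (by omega) (by omega)
        have h5 : lev (y (n + 2)) = lev (y (n + 1)) + 1 ∨ lev (y (n + 1)) = lev (y (n + 2)) + 1 ∨
            (Even t ∧ lev (y (n + 1)) = s + 1 ∧ _) := hisLink (hl (n + 1))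
        change lev (y (n + 2)) = n + 2
        rcases h5 with h5 | h5 | h5
        · omega
        · exact (hturn n (by omega) (by omega) (by omega) (fun _ => by omega)).elim
        · omega
  have hslow : ∀ n m, lev (y n) ≤ lev (y (n + m)) + m := by
    intro n m
    induction m with
    | zero => simp
    | succ m ih =>
      have := hisLink (hl (n + m))
      rw [add_assoc] at this
      omega
  have hL : s + 1 < k + 1 := by
    by_contra hL
    have := hup (k + 1) (by omega) le_rfl
    omega
  have hs1 := hup (s + 1) le_rfl hL.le
  have hs0 := hup s (Nat.le_succ s) (by omega)
  have hslow1 := hslow (s + 1) (k - s)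
  rw [show s + 1 + (k - s) = k + 1 by omega] at hslow1
  -- For `t = 2 * s + 2` edges down are unique in the last level too, so a step within that level
  -- comes in between and the length is at least `2 * s + 3`.
  rcases Nat.even_or_odd t with ht | ht
  · have h1 : lev (y (s + 2)) = s + 1 := by
      have h2 := hle (s + 2)
      rcases hisLink (hl (s + 1)) with h3 | h3 | h3
      · have : lev (y (s + 2)) = lev (y (s + 1)) + 1 := h3
        omega
      · have : lev (y (s + 1)) = lev (y (s + 2)) + 1 := h3
        exact (hturn s hL (by omega) (by omega)
          (fun ho => absurd ht (Nat.not_even_iff_odd.2 ho))).elim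
      · exact h3.2.2.1
    have hslow2 := hslow (s + 2) (k - s - 1)
    rw [show s + 2 + (k - s - 1) = k + 1 by omega] at hslow2
    obtain ⟨a, ha⟩ := ht
    omega
  · obtain ⟨a, ha⟩ := ht
    omega

end IsTreeLike

section ExpandRoot

variable {r t a₀ : ℕ} {G : Graph α β} {root : α} {A : Graph γ δ} {cB : β → ι}
  {cA : δ → Option ι}

/-- The projection of the vertices of `expandRoot` to those of `G`. -/
def expandRootProj (root : α) (p : Option (α × γ)) : α := p.elim root Prod.fst

/-- The projection of the edges of `expandRoot` to those of `G`. -/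
def expandRootEdgeProj : (β × δ × Sym2 (α × γ)) ⊕ (β × γ) → β := Sum.elim Prod.fst Prod.fst

theorem expandRoot_isLink_proj {e : (β × δ × Sym2 (α × γ)) ⊕ (β × γ)} {p q : Option (α × γ)}
    (h : (G.expandRoot root A cB cA).IsLink e p q) :
    G.IsLink (expandRootEdgeProj e) (expandRootProj root p) (expandRootProj root q) := by
  rcases e with e | ⟨d, u⟩
  · obtain ⟨x, y, rfl, rfl, h⟩ := h
    exact (base_isLink.1 h.1).1
  · obtain ⟨v, hv, hu, h, ⟨rfl, rfl⟩ | ⟨rfl, rfl⟩⟩ := h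
    · exact h
    · exact h.symm

/-- Edges at `v` lift to edges at `(v, u)`: a perfect matching of each colour provides the partner
of `u`. With `expandRoot_inc_injective`, where the uniqueness of that partner is used, this makes
the projection a local bijection away from the root, so degrees and unique edges down carry over. -/
theorem exists_expandRoot_isLink
    (hA : ∀ i : ι, ∀ u ∈ V(A), ∃! f, A.Inc f u ∧ cA f = some i) {v x : α} {u : γ} {e : β}
    (hv : v ≠ root) (hu : u ∈ V(A)) (h : G.IsLink e v x) :
    ∃ e' q, (G.expandRoot root A cB cA).IsLink e' (some (v, u)) q ∧ expandRootEdgeProj e' = e ∧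
      expandRootProj root q = x := by
  by_cases hx : x = root
  · subst hx
    exact ⟨.inr (e, u), none, ⟨v, hv, hu, h.symm, Or.inr ⟨rfl, rfl⟩⟩, rfl, rfl⟩
  · obtain ⟨f, ⟨⟨w, hw⟩, hf⟩, -⟩ := hA (cB e) u hu
    exact ⟨.inl (e, f, s((v, u), (x, w))), some (x, w), ⟨(v, u), (x, w), rfl, rfl,
      base_isLink.2 ⟨h, hv, hx⟩, hw, hf, rfl⟩, rfl, rfl⟩

theorem expandRoot_inc_injective
    (hA : ∀ i : ι, ∀ u ∈ V(A), ∃! f, A.Inc f u ∧ cA f = some i) {v : α} {u : γ}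
    {e f : (β × δ × Sym2 (α × γ)) ⊕ (β × γ)}
    (he : (G.expandRoot root A cB cA).Inc e (some (v, u)))
    (hf : (G.expandRoot root A cB cA).Inc f (some (v, u)))
    (hef : expandRootEdgeProj e = expandRootEdgeProj f) : e = f := by
  obtain ⟨p, hp⟩ := he
  obtain ⟨q, hq⟩ := hf
  rcases e with ⟨e, g, z⟩ | ⟨d, w⟩ <;> rcases f with ⟨f, g', z'⟩ | ⟨d', w'⟩
  · obtain rfl : e = f := hef
    obtain ⟨x, y, hx, rfl, h1, h2, h3, h4⟩ := hp
    obtain ⟨x', y', hx', rfl, h1', h2', h3', h4'⟩ := hq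
    obtain rfl := Option.some_injective _ hx
    obtain rfl := Option.some_injective _ hx'
    obtain rfl : g = g' := (hA (cB e) u h2.left_mem).unique ⟨h2.inc_left, h3⟩ ⟨h2'.inc_left, h3'⟩
    obtain rfl : y = y' := Prod.ext (h1.right_unique h1') (h2.right_unique h2')
    dsimp only at h4 h4'
    rw [h4, h4']
  · obtain rfl : e = d' := hef
    obtain ⟨x, y, hx, rfl, h1, -⟩ := hp
    obtain ⟨v', -, -, h2, -⟩ := hq
    have h3 := base_isLink.1 h1
    rcases h2.left_eq_or_eq h3.1 with h4 | h4
    · exact (h3.2.1 h4.symm).elim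
    · exact (h3.2.2 h4.symm).elim
  · obtain rfl : d = f := hef
    obtain ⟨x, y, hx, rfl, h1, -⟩ := hq
    obtain ⟨v', -, -, h2, -⟩ := hp
    have h3 := base_isLink.1 h1
    rcases h2.left_eq_or_eq h3.1 with h4 | h4
    · exact (h3.2.1 h4.symm).elim
    · exact (h3.2.2 h4.symm).elim
  · obtain rfl : d = d' := hef
    obtain ⟨v₁, -, -, -, h1⟩ := hp
    obtain ⟨v₂, -, -, -, h2⟩ := hq
    have h1 : w = u := by
      rcases h1 with h1 | h1 <;> simp at h1
      exact h1.1.2.symm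
    have h2 : w' = u := by
      rcases h2 with h2 | h2 <;> simp at h2
      exact h2.1.2.symm
    rw [h1, h2]

theorem deg_expandRoot
    (hA : ∀ i : ι, ∀ u ∈ V(A), ∃! f, A.Inc f u ∧ cA f = some i) {v : α} {u : γ}
    (hv : v ≠ root) (hu : u ∈ V(A)) :
    (G.expandRoot root A cB cA).deg (some (v, u)) = G.deg v := by
  have hinj : Set.InjOn expandRootEdgeProj
      {e | (G.expandRoot root A cB cA).Inc e (some (v, u))} :=
    fun e he f hf => expandRoot_inc_injective hA he hf
  rw [deg, deg, ← hinj.ncard_image]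
  congr 1
  ext e
  constructor
  · rintro ⟨e', ⟨q, hq⟩, rfl⟩
    exact ⟨_, expandRoot_isLink_proj hq⟩
  · rintro ⟨x, hx⟩
    obtain ⟨e', q, h1, h2, -⟩ := exists_expandRoot_isLink (cB := cB) hA hv hu hx
    exact ⟨e', h1.inc_left, h2⟩

theorem deg_expandRoot_none [G.Loopless] :
    (G.expandRoot root A cB cA).deg none = G.deg root * V(A).ncard := by
  have hset : {e | (G.expandRoot root A cB cA).Inc e none} =
      Sum.inr '' ({d | G.Inc d root} ×ˢ V(A)) := by
    ext e
    constructor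
    · rintro ⟨q, hq⟩
      rcases e with e | ⟨d, u⟩
      · obtain ⟨x, y, h, -⟩ := hq
        exact absurd h (by simp)
      · obtain ⟨v, -, hu, h, -⟩ := hq
        exact ⟨(d, u), ⟨h.inc_left, hu⟩, rfl⟩
    · rintro ⟨⟨d, u⟩, ⟨⟨v, h⟩, hu⟩, rfl⟩
      exact ⟨some (v, u), v, h.ne.symm, hu, h, Or.inl ⟨rfl, rfl⟩⟩
  rw [deg, deg, ← Set.ncard_prod, hset, Set.ncard_image_of_injective _ Sum.inr_injective]

theorem mem_expandRoot {p : Option (α × γ)} :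
    p ∈ V(G.expandRoot root A cB cA) ↔
      p = none ∨ ∃ v ∈ V(G), v ≠ root ∧ ∃ u ∈ V(A), p = some (v, u) := by
  constructor
  · rintro (h | ⟨⟨v, u⟩, ⟨hv, hu⟩, rfl⟩)
    · exact Or.inl h
    · rw [base, vertexSet_deleteVerts] at hv
      exact Or.inr ⟨v, hv.1, hv.2, u, hu, rfl⟩
  · rintro (rfl | ⟨v, hv, hvr, u, hu, rfl⟩)
    · exact Or.inl rfl
    · refine Or.inr ⟨(v, u), ⟨?_, hu⟩, rfl⟩
      rw [base, vertexSet_deleteVerts]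
      exact ⟨hv, hvr⟩

/-- The expansion of a tree-like graph, with a new root, is tree-like. -/
theorem IsTreeLike.expandRoot {lev : α → ℕ} (h : G.IsTreeLike r t a₀ root lev)
    (hA : ∀ i : ι, ∀ u ∈ V(A), ∃! f, A.Inc f u ∧ cA f = some i) :
    (G.expandRoot root A cB cA).IsTreeLike r t (a₀ * V(A).ncard) none
      (fun p => p.elim 0 fun x => lev x.1) := by
  have hll := h.loopless
  have hlev0 : lev root = 0 := (h.lev_eq_zero _ h.root_mem).2 rfl
  have hlev : (fun p : Option (α × γ) => p.elim 0 fun x => lev x.1) =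
      fun p => lev (expandRootProj root p) := by
    funext p
    cases p
    · exact hlev0.symm
    · rfl
  rw [hlev]
  refine ⟨mem_expandRoot.2 (Or.inl rfl), ?_, ?_, ?_, ?_, ?_, ?_⟩
  · intro p hp
    rcases mem_expandRoot.1 hp with rfl | ⟨v, hv, hvr, u, hu, rfl⟩
    · exact iff_of_true hlev0 rfl
    · simpa [expandRootProj, h.lev_eq_zero v hv] using hvr
  · intro p hp
    rcases mem_expandRoot.1 hp with rfl | ⟨v, hv, hvr, u, hu, rfl⟩
    · exact h.lev_le _ h.root_mem
    · exact h.lev_le v hv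
  · rw [deg_expandRoot_none, h.deg_root]
  · intro p hp hpn
    rcases mem_expandRoot.1 hp with rfl | ⟨v, hv, hvr, u, hu, rfl⟩
    · exact (hpn rfl).elim
    · rw [deg_expandRoot hA hvr hu, h.deg_eq v hv hvr]
  · intro e p q hpq
    rcases h.isLink (expandRoot_isLink_proj hpq) with h1 | h1 | h1
    · exact Or.inl h1
    · exact Or.inr (Or.inl h1)
    · exact Or.inr (Or.inr ⟨h1.1, h1.2.1, h1.2.2.1, fun h2 => h1.2.2.2 (congrArg _ h2)⟩)
  · intro p hp hpn hodd
    rcases mem_expandRoot.1 hp with rfl | ⟨v, hv, hvr, u, hu, rfl⟩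
    · exact (hpn rfl).elim
    · obtain ⟨e, ⟨x, hx, hxl⟩, huniq⟩ := h.existsUnique_down v hv hvr hodd
      obtain ⟨e', q, h1, h2, h3⟩ := exists_expandRoot_isLink (cB := cB) hA hvr hu hx
      refine ⟨e', ⟨q, h1, (congrArg lev h3).trans_lt hxl⟩, ?_⟩
      rintro f ⟨q', hq', hlt⟩
      refine expandRoot_inc_injective hA hq'.inc_left h1.inc_left ?_
      rw [h2]
      exact huniq _ ⟨_, expandRoot_isLink_proj hq', hlt⟩

/-- Cycles through the new root are long by `lt_of_isCycle`; all others lie in the expansion of the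
base graph. Hence only the base graph has to be properly coloured. -/
theorem IsTreeLike.le_girth_expandRoot {lev : α → ℕ} (h : G.IsTreeLike r t a₀ root lev)
    (hB : (G.base root).IsProperEdgeColouring cB)
    (hA : ∀ i : ι, ∀ u ∈ V(A), ∃! f, A.Inc f u ∧ cA f = some i)
    (hg : ((t + 1 : ℕ) : ℕ∞) ≤ A.girth) :
    ((t + 1 : ℕ) : ℕ∞) ≤ (G.expandRoot root A cB cA).girth := by
  refine le_girth_iff.2 fun k x e hc => ?_
  by_cases hx : ∃ i, x i = none
  · obtain ⟨i, hi⟩ := hx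
    exact (h.expandRoot hA).lt_of_isCycle hc hi
  · push Not at hx
    have hx' : ∀ i, ∃ y, x i = some y := fun i => Option.ne_none_iff_exists'.1 (hx i)
    choose y hy using hx'
    have he : ∀ i, ∃ f, e i = .inl f ∧
        ((G.base root).expand A cB cA).IsLink f (y i) (y (i + 1)) := by
      intro i
      have h1 := hc.isLink i
      rw [hy, hy] at h1
      rcases hei : e i with f | ⟨d, u⟩ <;> rw [hei] at h1
      · obtain ⟨a, b, h2, h3, h4⟩ := h1
        rw [Option.some_injective _ h2, Option.some_injective _ h3]
        exact ⟨f, rfl, h4⟩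
      · obtain ⟨v, -, -, -, h2 | h2⟩ := h1
        · exact absurd h2.1 (by simp)
        · exact absurd h2.2 (by simp)
    choose f hf hl using he
    refine le_girth_iff.1 (le_girth_expand hB hg) k y f ⟨fun i j hij => ?_, fun i j hij => ?_, hl⟩
    · exact hc.vertex_injective (by rw [hy, hy, hij])
    · exact hc.edge_injective (by rw [hf, hf, hij])

end ExpandRoot

end Graph

/-! ### Auxiliary graphs -/

namespace Graph

/-- The Cayley graph of a group with respect to a family of involutions; the edges are labelled by
the involutions. -/
def cayley {Γ C : Type*} [Group Γ] (σ : C → Γ) (hσ : ∀ c, σ c * σ c = 1) :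
    Graph Γ (C × Sym2 Γ) where
  vertexSet := Set.univ
  IsLink e x y := e.2 = s(x, y) ∧ y = x * σ e.1
  isLink_symm := fun e _ => ⟨fun x y h => ⟨by rw [h.1, Sym2.eq_swap], by
    rw [h.2, mul_assoc, hσ, mul_one]⟩⟩
  eq_or_eq_of_isLink_of_isLink := fun e x y v w h h' => by
    rcases Sym2.eq_iff.1 (h.1.symm.trans h'.1) with h | h
    · exact Or.inl h.1
    · exact Or.inr h.1
  left_mem_of_isLink := fun _ _ _ _ => Set.mem_univ _

/-- Reduced words of length at most `n`. -/
abbrev ReducedWord (C : Type*) (n : ℕ) : Type _ :=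
  {l : List C // l.length ≤ n ∧ l.IsChain (· ≠ ·)}

namespace ReducedWord

variable {C : Type*} {n : ℕ}

instance [Finite C] : Finite (ReducedWord C n) :=
  ((List.finite_length_le C n).subset fun _ h => h.1).to_subtype

/-- Cancel the letter `c` at the beginning of a reduced word or, if there is none and the word is
not too long, put it there. -/
noncomputable def toggle (c : C) (l : ReducedWord C n) : ReducedWord C n :=
  if h : l.1.head? = some c then
    ⟨l.1.tail, by
      have := l.2.1
      rw [List.length_tail]
      omega, l.2.2.tail⟩
  else if h' : l.1.length < n then
    ⟨c :: l.1, by simpa using h', by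
      rw [List.isChain_cons]
      exact ⟨fun y hy hc => h (hc ▸ hy), l.2.2⟩⟩
  else l

theorem toggle_involutive (c : C) : Function.Involutive (toggle (n := n) c) := by
  rintro ⟨l, hl, hc⟩
  cases l with
  | nil =>
    by_cases h : 0 < n <;> simp [toggle, h]
  | cons a l =>
    by_cases h : a = c
    · subst h
      have h1 : l.head? ≠ some a := fun h1 => (List.isChain_cons.1 hc).1 a h1 rfl
      have h2 : l.length < n := by simpa using hl
      simp [toggle, h1, h2]
    · by_cases h' : (a :: l).length < n
      · simp only [List.length_cons] at h'
        simp [toggle, h, h']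
      · simp only [List.length_cons] at h'
        simp [toggle, h, h']

/-- The involution `toggle c`, as a permutation. -/
noncomputable def togglePerm (c : C) : Equiv.Perm (ReducedWord C n) := (toggle_involutive c).toPerm

theorem togglePerm_mul_self (c : C) : togglePerm (n := n) c * togglePerm c = 1 :=
  Equiv.ext (toggle_involutive c)

end ReducedWord

open ReducedWord

/-- Let the generators along a walk without turning back act on the empty word. Consecutive letters
differ, so each step prepends a letter as long as the length is below `n`. After `m` steps with `1 ≤
m ≤ n` the word has length `m`, and the walk cannot be closed. -/
theorem lt_girth_cayley_togglePerm {C : Type*} (n : ℕ) :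
    ((n + 1 : ℕ) : ℕ∞) ≤
      (cayley (togglePerm (C := C) (n := n)) togglePerm_mul_self).girth := by
  refine le_girth_iff.2 fun k x e hc => ?_
  obtain ⟨y, f, hy0, hyk, hl, -, -, hne⟩ := hc.exists_walk 0
  by_contra hkn
  have hne' : ∀ a, a + 1 < k + 1 → (f a).1 ≠ (f (a + 1)).1 := by
    intro a ha h
    refine hne a (a + 1) (Nat.lt_succ_self a) ha (Prod.ext h ?_)
    have h1 := (hl (a + 1)).2
    rw [(hl a).2, mul_assoc, ← h, togglePerm_mul_self, mul_one] at h1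
    rw [(hl a).1, (hl (a + 1)).1, h1, Sym2.eq_swap]
  let w₀ : ReducedWord C n := ⟨[], by simp, by simp⟩
  have key : ∀ m ≤ k + 1, ((y m)⁻¹ (y 0 w₀)).1.length = m ∧
      ∀ l, m = l + 1 → ((y m)⁻¹ (y 0 w₀)).1.head? = some (f l).1 := by
    intro m
    induction m with
    | zero => exact fun _ => ⟨by simp [w₀], fun l hl => by omega⟩
    | succ m ih =>
      intro hm
      obtain ⟨h1, h2⟩ := ih (by omega)
      have h3 : (y (m + 1))⁻¹ (y 0 w₀) = toggle (f m).1 ((y m)⁻¹ (y 0 w₀)) := by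
        rw [(hl m).2, mul_inv_rev, inv_eq_of_mul_eq_one_left (togglePerm_mul_self _)]
        rfl
      have h4 : ((y m)⁻¹ (y 0 w₀)).1.head? ≠ some (f m).1 := by
        intro h4
        cases m with
        | zero => simp [w₀] at h4
        | succ m =>
          rw [h2 m rfl] at h4
          exact hne' m (by omega) (Option.some_injective _ h4)
      rw [h3, toggle, dif_neg h4, dif_pos (by omega)]
      refine ⟨congrArg (· + 1) h1, fun l hl => ?_⟩
      obtain rfl : m = l := by omega
      rfl
  have := (key (k + 1) le_rfl).1
  rw [hyk, ← hy0] at this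
  simp [w₀] at this

/-- The group of all permutations of the reduced words of length at most `t` serves. Its order is
the factorial of a number that is at least two, hence even, and the edges of each generator form a
perfect matching. -/
theorem exists_isAuxiliary (r t : ℕ) (ht : 1 ≤ t) :
    ∃ (U D : Type) (_ : Finite U) (_ : Finite D) (A : Graph U D)
      (cA : D → Option (Fin (r + 1))), V(A).Nonempty ∧ A.IsAuxiliary r t cA := by
  refine ⟨Equiv.Perm (ReducedWord (Fin (r + 1)) t), _, inferInstance, inferInstance,
    cayley togglePerm togglePerm_mul_self, fun e => some e.1, ⟨1, Set.mem_univ _⟩, ?_, ?_,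
    lt_girth_cayley_togglePerm t, ?_⟩
  · change Even (Set.univ : Set (Equiv.Perm (ReducedWord (Fin (r + 1)) t))).ncard
    rw [Set.ncard_univ, Nat.card_perm, even_iff_two_dvd]
    refine Nat.dvd_factorial two_pos ?_
    have : Nontrivial (ReducedWord (Fin (r + 1)) t) :=
      ⟨⟨[], by simp, by simp⟩, ⟨[0], by simpa using ht, by simp⟩, fun h => by
        simpa using congrArg Subtype.val h⟩
    exact Finite.one_lt_card
  · intro u _
    have h1 : Function.Injective fun i : Fin (r + 1) =>
        (i, s(u, u * togglePerm (n := t) i)) := fun i j h => congrArg Prod.fst h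
    have h2 := Set.ncard_image_of_injective Set.univ h1
    rw [Set.ncard_univ, Nat.card_fin] at h2
    refine h2.symm.trans_le (Set.ncard_le_ncard ?_)
    rintro _ ⟨i, -, rfl⟩
    exact ⟨_, rfl, rfl⟩
  · intro i u _
    refine ⟨(i, s(u, u * togglePerm i)), ⟨⟨_, rfl, rfl⟩, rfl⟩, ?_⟩
    rintro ⟨j, z⟩ ⟨⟨y, hz, hy⟩, hj⟩
    obtain rfl := Option.some_injective _ hj
    dsimp only at hz hy
    rw [hz, hy]

end Graph

/-! ### The rate bound -/

section Hypergraph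

variable {κ ι : Type*}

/-- The breadth-first levels of the vertices of a hypergraph: the vertices that are edges are at
level `0`, and the edges with two vertices lead from one level to the next. Levels above `K` are
not distinguished. -/
theorem exists_level (N : ι → Finset κ) (K : ℕ) : ∃ lev : κ → ℕ,
    (∀ e v, N e = {v} → lev v = 0) ∧ (∀ e u v, N e = {u, v} → lev v ≤ lev u + 1) ∧
    ∀ v, lev v < K → ∃ e, N e = {v} ∨ ∃ u, N e = {u, v} ∧ lev v = lev u + 1 := by
  let W : ℕ → Set κ := fun n =>
    Nat.rec {v | ∃ e, N e = {v}} (fun _ W => {v | ∃ e, ∃ u ∈ W, N e = {u, v}}) n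
  have hW : ∀ n, W (n + 1) = {v | ∃ e, ∃ u ∈ W n, N e = {u, v}} := fun n => rfl
  let lev : κ → ℕ := fun v => sInf {i | v ∈ W i ∨ i = K}
  have hne : ∀ v, {i | v ∈ W i ∨ i = K}.Nonempty := fun v => ⟨K, Or.inr rfl⟩
  have hmem : ∀ v, v ∈ W (lev v) ∨ lev v = K := fun v => Nat.sInf_mem (hne v)
  have hle : ∀ v i, v ∈ W i → lev v ≤ i := fun v i h => Nat.sInf_le (Or.inl h)
  have hleK : ∀ v, lev v ≤ K := fun v => Nat.sInf_le (Or.inr rfl)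
  have hstep : ∀ e u v, N e = {u, v} → lev v ≤ lev u + 1 := by
    intro e u v he
    rcases hmem u with h | h
    · exact hle _ _ ⟨e, u, h, he⟩
    · have := hleK v
      omega
  refine ⟨lev, fun e v he => Nat.le_zero.1 (hle v 0 ⟨e, he⟩), hstep, fun v hv => ?_⟩
  have h := (hmem v).resolve_right hv.ne
  rcases hi : lev v with _ | i
  · rw [hi] at h
    obtain ⟨e, he⟩ := h
    exact ⟨e, Or.inl he⟩
  · rw [hi, hW] at h
    obtain ⟨e, u, hu, he⟩ := h
    have h1 := hle u i hu
    have h2 := hstep e u v he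
    exact ⟨e, Or.inr ⟨u, he, by omega⟩⟩

/-- A discharging argument: in a hypergraph with vertex degrees at most `r + 1` in which any `k ≤ t`
edges have at least `k` vertices, every vertex at level `i` gives the amount `x i` to the edge that
leads to it from below, and `y i` to its other edges. -/
theorem card_le_of_discharging [Fintype κ] [Fintype ι] (N : ι → Finset κ) {r t : ℕ} (ht : 1 ≤ t)
    (hdeg : ∀ v, (Finset.univ.filter fun e => v ∈ N e).card ≤ r + 1)
    (hall : ∀ T : Finset ι, T.card ≤ t → T.card ≤ (T.biUnion N).card) (x y : ℕ → ℚ) (M : ℚ)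
    (hx0 : 1 ≤ x 0) (hxy : ∀ i, 1 ≤ x (i + 1) + y i) (hy3 : ∀ i, 1 / 3 ≤ y i)
    (hy2 : ∀ i, t < 2 * i + 3 → 1 / 2 ≤ y i) (hM : ∀ i, x i + r * y i ≤ M)
    (hyx : ∀ i, y i ≤ x i) (heq : ∀ i, t < 2 * i + 2 → x i = y i) :
    (Fintype.card ι : ℚ) ≤ Fintype.card κ * M := by
  rcases isEmpty_or_nonempty ι with hι | hι
  · have h1 := hy3 0
    have h2 : (0 : ℚ) ≤ r * y 0 := by positivity
    have h3 : 0 ≤ M := by linarith [hM 0, hyx 0]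
    rw [Fintype.card_eq_zero, Nat.cast_zero]
    positivity
  obtain ⟨lev, hlev0, hlev1, hlev⟩ := exists_level N (t + 1)
  let Down : ι → κ → Prop := fun e v => N e = {v} ∨ ∃ u, N e = {u, v} ∧ lev v = lev u + 1
  have hdown_inj : ∀ e v w, Down e v → Down e w → v = w := by
    rintro e v w (h1 | ⟨u, h1, h2⟩) (h3 | ⟨u', h3, h4⟩)
    · rw [h1] at h3
      exact Finset.singleton_injective h3
    · rw [h1] at h3
      have h5 : u' ∈ ({v} : Finset κ) := by rw [h3]; simp
      have h6 : w ∈ ({v} : Finset κ) := by rw [h3]; simp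
      rw [Finset.mem_singleton] at h5 h6
      exact h6.symm
    · rw [h1] at h3
      have h6 : v ∈ ({w} : Finset κ) := by rw [← h3]; simp
      exact Finset.mem_singleton.1 h6
    · have h5 : v ∈ ({u', w} : Finset κ) := by rw [← h3, h1]; simp
      have h6 : w ∈ ({u, v} : Finset κ) := by rw [← h1, h3]; simp
      rw [Finset.mem_insert, Finset.mem_singleton] at h5 h6
      rcases h5 with rfl | h5
      · rcases h6 with rfl | h6
        · omega
        · exact h6.symm
      · exact h5
  have hd : ∀ v, ∃ e, lev v ≤ t → Down e v := by
    intro v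
    by_cases hv : lev v ≤ t
    · obtain ⟨e, he⟩ := hlev v (by omega)
      exact ⟨e, fun _ => he⟩
    · exact ⟨Classical.arbitrary ι, fun h => (hv h).elim⟩
  choose d hd using hd
  -- `Q` is the path obtained by following the chosen edges `d` from `v` down to level `0`.
  have hclosed : ∀ k v, lev v = k → k ≤ t → ∃ Q : Finset κ, v ∈ Q ∧ Q.card ≤ k + 1 ∧
      ∀ w ∈ Q, lev w ≤ t ∧ N (d w) ⊆ Q := by
    intro k
    induction k using Nat.strong_induction_on with
    | _ k ih =>
    intro v hv hk
    rcases hd v (by omega) with h1 | ⟨u, h1, h2⟩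
    · refine ⟨{v}, by simp, by simp, fun w hw => ?_⟩
      rw [Finset.mem_singleton] at hw
      subst hw
      exact ⟨by omega, h1.subset⟩
    · obtain ⟨Q, hQ1, hQ2, hQ3⟩ := ih (lev u) (by omega) u rfl (by omega)
      refine ⟨insert v Q, by simp, (Finset.card_insert_le _ _).trans (by omega), fun w hw => ?_⟩
      rcases Finset.mem_insert.1 hw with rfl | hw
      · refine ⟨by omega, ?_⟩
        rw [h1]
        intro z hz
        rcases Finset.mem_insert.1 hz with rfl | hz
        · exact Finset.mem_insert_of_mem hQ1
        · rw [Finset.mem_singleton] at hz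
          simp [hz]
      · exact ⟨(hQ3 w hw).1, (hQ3 w hw).2.trans (Finset.subset_insert _ _)⟩
  -- The edges `d w`, `w ∈ Q`, are distinct. Together with `e` they are `Q.card + 1` edges with all
  -- their vertices in `Q`, contrary to `hall`.
  have hexcess : ∀ (Q : Finset κ) e, (∀ w ∈ Q, lev w ≤ t ∧ N (d w) ⊆ Q) → N e ⊆ Q →
      (∀ w ∈ Q, d w ≠ e) → Q.card + 1 ≤ t → False := by
    intro Q e hQ he hne hcard
    have h1 : (insert e (Q.image d)).card = Q.card + 1 := by
      rw [Finset.card_insert_of_notMem, Finset.card_image_of_injOn]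
      · intro v hv w hw hvw
        have h2 := hd v (hQ v hv).1
        rw [hvw] at h2
        exact hdown_inj _ _ _ h2 (hd w (hQ w hw).1)
      · rw [Finset.mem_image]
        rintro ⟨w, hw, h2⟩
        exact hne w hw h2
    have h2 := hall (insert e (Q.image d)) (by omega)
    have h3 : (insert e (Q.image d)).biUnion N ⊆ Q := by
      rw [Finset.biUnion_subset]
      intro f hf
      rcases Finset.mem_insert.1 hf with rfl | hf
      · exact he
      · obtain ⟨w, hw, rfl⟩ := Finset.mem_image.1 hf
        exact (hQ w hw).2
    have := Finset.card_le_card h3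
    omega
  have hunion : ∀ u v, lev u ≤ t → lev v ≤ t → ∃ Q : Finset κ, u ∈ Q ∧ v ∈ Q ∧
      Q.card ≤ lev u + lev v + 2 ∧ ∀ w ∈ Q, lev w ≤ t ∧ N (d w) ⊆ Q := by
    intro u v hu hv
    obtain ⟨Q, h1, h2, h3⟩ := hclosed _ u rfl hu
    obtain ⟨Q', h1', h2', h3'⟩ := hclosed _ v rfl hv
    refine ⟨Q ∪ Q', Finset.mem_union_left _ h1, Finset.mem_union_right _ h1',
      (Finset.card_union_le _ _).trans (by omega), fun w hw => ?_⟩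
    rcases Finset.mem_union.1 hw with hw | hw
    · exact ⟨(h3 w hw).1, (h3 w hw).2.trans Finset.subset_union_left⟩
    · exact ⟨(h3' w hw).1, (h3' w hw).2.trans Finset.subset_union_right⟩
  -- A second edge down from level `i` would be an excess edge for the union of two paths, with at
  -- most `i` and `i + 1` vertices, so at most `2 * i + 2` edges are involved (two if `i = 0`).
  have hunique : ∀ e v, 2 * lev v + 2 ≤ t → Down e v → d v = e := by
    intro e v hv he
    by_contra hne
    have hnotmem : ∀ (Q : Finset κ), (∀ w ∈ Q, lev w ≤ t ∧ N (d w) ⊆ Q) → ∀ w ∈ Q, d w ≠ e := by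
      intro Q hQ w hw h1
      have h2 := hd w (hQ w hw).1
      rw [h1] at h2
      rw [hdown_inj _ _ _ h2 he] at h1
      exact hne h1
    rcases id he with h1 | ⟨u, h1, h2⟩
    · obtain ⟨Q, hQ1, hQ2, hQ3⟩ := hclosed _ v rfl (by omega)
      have := hlev0 _ _ h1
      exact hexcess Q e hQ3 (by simpa [h1] using hQ1) (hnotmem Q hQ3) (by omega)
    · obtain ⟨Q, hu, hv', hcard, hQ⟩ := hunion u v (by omega) (by omega)
      refine hexcess Q e hQ ?_ (hnotmem Q hQ) (by omega)
      rw [h1, Finset.insert_subset_iff, Finset.singleton_subset_iff]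
      exact ⟨hu, hv'⟩
  -- An edge between two vertices of level `i` is an excess edge for two paths with at most `i + 1`
  -- vertices each.
  have hlevel : ∀ e u v, u ≠ v → N e = {u, v} → lev u = lev v → t < 2 * lev v + 3 := by
    intro e u v huv he hl
    by_contra ht'
    obtain ⟨Q, hu, hv', hcard, hQ⟩ := hunion u v (by omega) (by omega)
    refine hexcess Q e hQ ?_ ?_ (by omega)
    · rw [he, Finset.insert_subset_iff, Finset.singleton_subset_iff]
      exact ⟨hu, hv'⟩
    · intro w hw h1
      have hl' : ∀ z ∈ N e, lev z = lev v := by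
        intro z hz
        rw [he, Finset.mem_insert, Finset.mem_singleton] at hz
        rcases hz with rfl | rfl
        · exact hl
        · rfl
      have h2 := hd w (hQ w hw).1
      rw [h1] at h2
      rcases h2 with h2 | ⟨z, h2, h3⟩
      · have hu' : u ∈ N e := by rw [he]; simp
        have hv' : v ∈ N e := by rw [he]; simp
        rw [h2, Finset.mem_singleton] at hu' hv'
        exact huv (hu'.trans hv'.symm)
      · have hz : z ∈ N e := by rw [h2]; simp
        have hw' : w ∈ N e := by rw [h2]; simp
        have := hl' z hz
        have := hl' w hw'
        omega
  let φ : κ → ι → ℚ := fun v e => if Down e v then x (lev v) else y (lev v)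
  have hφy : ∀ v e, y (lev v) ≤ φ v e := by
    intro v e
    simp only [φ]
    split_ifs
    · exact hyx _
    · exact le_rfl
  have hcol2 : ∀ e u v, u ≠ v → N e = {u, v} → lev u ≤ lev v → 1 ≤ φ u e + φ v e := by
    intro e u v huv he hle
    have h1 := hφy u e
    rcases hle.eq_or_lt with h2 | h2
    · have h3 := hφy v e
      have h4 := hy2 _ (hlevel e u v huv he h2)
      rw [h2] at h1
      linarith
    · have h3 := hlev1 e u v he
      have h4 : lev v = lev u + 1 := by omega
      have h5 : φ v e = x (lev u + 1) := by
        rw [← h4]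
        exact if_pos (Or.inr ⟨u, he, h4⟩)
      have := hxy (lev u)
      linarith
  -- Three or more vertices give at least `1 / 3` each. With two vertices, the levels are equal,
  -- hence high, and both give at least `1 / 2`, or they are consecutive and `hxy` applies. A single
  -- vertex is at level `0`.
  have hcol : ∀ e, 1 ≤ ∑ v ∈ N e, φ v e := by
    intro e
    have h0 : 1 ≤ (N e).card := by simpa using hall {e} (by simpa using ht)
    rcases Nat.lt_or_ge 2 (N e).card with h3 | h3
    · have h1 : ∀ v ∈ N e, (1 / 3 : ℚ) ≤ φ v e := fun v _ => (hy3 _).trans (hφy v e)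
      have h2 := Finset.card_nsmul_le_sum _ _ _ h1
      have h4 : (3 : ℚ) ≤ (N e).card := by exact_mod_cast h3
      rw [nsmul_eq_mul] at h2
      linarith
    · rcases Nat.lt_or_ge 1 (N e).card with h2 | h2
      · obtain ⟨u, v, huv, he⟩ := Finset.card_eq_two.1 (by omega : (N e).card = 2)
        rw [he, Finset.sum_pair huv]
        rcases le_total (lev u) (lev v) with h4 | h4
        · exact hcol2 e u v huv he h4
        · rw [add_comm]
          exact hcol2 e v u huv.symm (by rw [he, Finset.pair_comm]) h4
      · obtain ⟨v, he⟩ := Finset.card_eq_one.1 (by omega : (N e).card = 1)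
        rw [he, Finset.sum_singleton]
        simp only [φ]
        rw [if_pos (Or.inl he), hlev0 e v he]
        exact hx0
  have hrow : ∀ v, ∑ e with v ∈ N e, φ v e ≤ M := by
    intro v
    have h1 : ∀ e, φ v e = y (lev v) + if Down e v then x (lev v) - y (lev v) else 0 := by
      intro e
      simp only [φ]
      split_ifs <;> ring
    simp only [h1]
    rw [Finset.sum_add_distrib, Finset.sum_const, nsmul_eq_mul, ← Finset.sum_filter,
      Finset.sum_const, nsmul_eq_mul]
    have h2 : ((Finset.univ.filter fun e => v ∈ N e).card : ℚ) ≤ r + 1 := by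
      exact_mod_cast hdeg v
    have h3 := hy3 (lev v)
    have h4 := mul_le_mul_of_nonneg_right h2 (by linarith : 0 ≤ y (lev v))
    have h5 := hM (lev v)
    rcases Nat.lt_or_ge t (2 * lev v + 2) with h6 | h6
    · have := heq _ h6
      rw [this] at h5 ⊢
      linarith
    · have h7 : (({e | v ∈ N e} : Finset ι).filter fun e => Down e v).card ≤ 1 := by
        rw [Finset.card_le_one]
        intro a ha b hb
        rw [Finset.mem_filter] at ha hb
        rw [← hunique a v h6 ha.2, ← hunique b v h6 hb.2]
      have h8 : ((({e | v ∈ N e} : Finset ι).filter fun e => Down e v).card : ℚ) ≤ 1 := by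
        exact_mod_cast h7
      have h9 := mul_le_mul_of_nonneg_right h8 (sub_nonneg.2 (hyx (lev v)))
      linarith
  calc (Fintype.card ι : ℚ) = ∑ _e : ι, (1 : ℚ) := by simp
    _ ≤ ∑ e, ∑ v ∈ N e, φ v e := Finset.sum_le_sum fun e _ => hcol e
    _ = ∑ v, ∑ e with v ∈ N e, φ v e := Finset.sum_comm' (by simp)
    _ ≤ ∑ _v : κ, M := Finset.sum_le_sum fun v _ => hrow v
    _ = Fintype.card κ * M := by simp

end Hypergraph

/-! ### Weights for the discharging -/

/-- The amounts for the discharging argument, in terms of a solution `c` of a linear recursion. -/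
theorem exists_weights_aux {r s t : ℕ} (hr : 3 ≤ r) (c : ℕ → ℚ) (hc : ∀ k, c (k + 1) = r * c k + 1)
    (hc0 : c 0 ≤ 0) (hc0' : -1 ≤ (r + 1) * c 0) (hcs : 0 < c (s + 1))
    (hts : 2 * s + 1 ≤ t) (hts' : t ≤ 2 * s + 2) (hodd : t = 2 * s + 1 → (r + 1) * c 0 = -1) :
    ∃ x y : ℕ → ℚ, 1 ≤ x 0 ∧ (∀ i, 1 ≤ x (i + 1) + y i) ∧ (∀ i, 1 / 3 ≤ y i) ∧
      (∀ i, t < 2 * i + 3 → 1 / 2 ≤ y i) ∧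
      (∀ i, x i + r * y i ≤ (r + 1) / 2 + 1 / (2 * c (s + 1))) ∧
      (∀ i, y i ≤ x i) ∧ ∀ i, t < 2 * i + 2 → x i = y i := by
  -- Put `M = (r + 1) / 2 + ε` and `y i = 1 / 2 - z i`. Equality in `x i + r * y i ≤ M` and in `1 ≤
  -- x (i + 1) + y i` amounts to `z i = r * z (i + 1) + ε`, solved by `z i = ε * c (s - i)`. Then `x
  -- 0 = 1` means `ε * c (s + 1) = 1 / 2`, which fixes `ε`. At the top, `c 0 = 0` gives `y s = 1 /
  -- 2`, and `(r + 1) * c 0 = -1` gives `x s = y s`.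
  set ε : ℚ := 1 / (2 * c (s + 1)) with hε
  have hεpos : 0 < ε := by positivity
  have hεc : ε * c (s + 1) = 1 / 2 := by
    rw [hε]
    field_simp
  have hr' : (3 : ℚ) ≤ r := by exact_mod_cast hr
  have hmono : ∀ k, c 0 ≤ c k ∧ c k ≤ c (k + 1) := by
    intro k
    induction k with
    | zero =>
      refine ⟨le_rfl, ?_⟩
      rw [hc]
      nlinarith
    | succ k ih =>
      refine ⟨ih.1.trans ih.2, ?_⟩
      rw [hc (k + 1), hc k]
      have := ih.2
      rw [hc k] at this
      nlinarith
  have hmono' : Monotone c := monotone_nat_of_le_succ fun k => (hmono k).2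
  have hlow : ∀ k, -1 ≤ (r + 1) * c k := fun k => by
    have := (hmono k).1
    nlinarith
  have hlow' : ∀ k, -ε ≤ (r + 1) * (ε * c k) := fun k => by
    have := mul_le_mul_of_nonneg_left (hlow k) hεpos.le
    linarith
  have hrec : ∀ k, ε * c (k + 1) = r * (ε * c k) + ε := fun k => by rw [hc]; ring
  -- Here `r ≥ 3` enters: `1 / 2 = r * (ε * c s) + ε`. The bound yields `1 / 3 ≤ y i`.
  have hup : ∀ k ≤ s, ε * c k ≤ 1 / 6 := by
    intro k hk
    have h1 := mul_le_mul_of_nonneg_left (hmono' hk) hεpos.le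
    have h2 := hrec s
    rw [hεc] at h2
    by_contra h3
    push Not at h3
    nlinarith
  have hε0 : ε * c 0 ≤ 0 := mul_nonpos_of_nonneg_of_nonpos hεpos.le hc0
  let y : ℕ → ℚ := fun i => 1 / 2 - ε * c (s - i)
  have hy : ∀ i, y i = 1 / 2 - ε * c (s - i) := fun i => rfl
  have hyM : ∀ i, (r + 1) * y i ≤ (r + 1) / 2 + ε := by
    intro i
    have := hlow' (s - i)
    rw [hy]
    linarith
  have hy0 : ∀ i, s ≤ i → y i = 1 / 2 - ε * c 0 := fun i hi => by
    rw [hy, Nat.sub_eq_zero_of_le hi]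
  -- Above level `s` edges down need not be unique, so there `x` has to agree with `y`.
  refine ⟨fun i => if s < i then y i else (r + 1) / 2 + ε - r * y i, y, ?_, ?_, ?_, ?_, ?_, ?_, ?_⟩
  · dsimp only
    rw [if_neg (Nat.not_lt_zero s), hy, Nat.sub_zero]
    have := hrec s
    linarith
  · intro i
    dsimp only
    split_ifs with h
    · rw [hy0 (i + 1) (by omega), hy0 i (by omega)]
      linarith
    · have h1 := hrec (s - (i + 1))
      rw [show s - (i + 1) + 1 = s - i by omega] at h1
      rw [hy, hy]
      linarith
  · intro i
    have := hup (s - i) (Nat.sub_le _ _)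
    rw [hy]
    linarith
  · intro i hi
    rw [hy0 i (by omega)]
    linarith
  · intro i
    dsimp only
    split_ifs with h
    · linarith [hyM i]
    · linarith
  · intro i
    dsimp only
    split_ifs with h
    · exact le_rfl
    · linarith [hyM i]
  · intro i hi
    dsimp only
    split_ifs with h
    · rfl
    · have h1 : i = s := by omega
      have h2 : ε * ((r + 1) * c 0) = -ε := by rw [hodd (by omega)]; ring
      rw [hy0 i (by omega)]
      linarith

/-- The solutions of the recursion are the geometric sums `P k` for even `t`, where `c 0 = 0`, and
`P k - r ^ k / (r + 1)` for odd `t`, where `c 0 = -1 / (r + 1)`. The value at `s + 1` determines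
`M`. -/
theorem exists_weights {r t : ℕ} (hr : 3 ≤ r) (ht : 1 ≤ t) :
    ∃ (x y : ℕ → ℚ) (M : ℚ), 0 < M ∧ rateBound r t = 1 - 1 / M ∧
      1 ≤ x 0 ∧ (∀ i, 1 ≤ x (i + 1) + y i) ∧ (∀ i, 1 / 3 ≤ y i) ∧
      (∀ i, t < 2 * i + 3 → 1 / 2 ≤ y i) ∧ (∀ i, x i + r * y i ≤ M) ∧
      (∀ i, y i ≤ x i) ∧ ∀ i, t < 2 * i + 2 → x i = y i := by
  set s := (t - 1) / 2 with hs
  let P : ℕ → ℚ := fun k => ∑ i ∈ Finset.range k, (r : ℚ) ^ i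
  have hP : ∀ k, P (k + 1) = r * P k + 1 := fun k => geom_sum_succ
  have hP' : P (s + 1) + (r : ℚ) ^ (s + 1) = r * P (s + 1) + 1 := by
    rw [← hP, ← Finset.sum_range_succ]
  have hP1 : 1 ≤ P (s + 1) := by
    rw [hP]
    have : 0 ≤ P s := Finset.sum_nonneg fun i _ => by positivity
    have : (0 : ℚ) ≤ r * P s := by positivity
    linarith
  have hr' : (3 : ℚ) ≤ r := by exact_mod_cast hr
  have hr0 : (r : ℚ) + 1 ≠ 0 := by positivity
  have hpow : (0 : ℚ) < (r : ℚ) ^ (s + 1) := by positivity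
  rcases Nat.even_or_odd t with he | ho
  · obtain ⟨x, y, h⟩ := exists_weights_aux (s := s) (t := t) hr P hP (by simp [P]) (by simp [P])
      (by linarith) (by omega) (by omega) (fun h => by obtain ⟨a, ha⟩ := he; omega)
    refine ⟨x, y, _, by positivity, ?_, h⟩
    have hI : ∑ i ∈ Finset.Icc 0 s, (r : ℚ) ^ i = P (s + 1) := by
      simp only [P]
      rw [Finset.range_eq_Ico]
      rfl
    rw [rateBound, if_pos he, ← hs, hI]
    have h1 : (0 : ℚ) < P (s + 1) := by linarith
    rw [show (r : ℚ) ^ (s + 1) = r * P (s + 1) + 1 - P (s + 1) by linarith]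
    have h2 : r * P (s + 1) + 1 - P (s + 1) + 2 * P (s + 1) ≠ 0 := by nlinarith
    have h3 : ((r : ℚ) + 1) / 2 + 1 / (2 * P (s + 1)) =
        (r * P (s + 1) + 1 - P (s + 1) + 2 * P (s + 1)) / (2 * P (s + 1)) := by
      field_simp
      ring
    rw [h3, one_div_div, eq_sub_iff_add_eq, ← add_div, div_self h2]
  · let c : ℕ → ℚ := fun k => P k - (r : ℚ) ^ k / (r + 1)
    have hc : ∀ k, c (k + 1) = r * c k + 1 := by
      intro k
      simp only [c]
      rw [hP, pow_succ]
      ring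
    have hc0 : (r + 1) * c 0 = -1 := by
      simp only [c, P, Finset.sum_range_zero, pow_zero]
      field_simp
      ring
    have hcs : (r + 1) * c (s + 1) = 2 * P (s + 1) - 1 := by
      simp only [c]
      rw [mul_sub, mul_div_cancel₀ _ hr0]
      linarith
    have hcpos : 0 < c (s + 1) := by
      by_contra h
      push Not at h
      nlinarith
    obtain ⟨x, y, h⟩ := exists_weights_aux (s := s) (t := t) hr c hc (by nlinarith) hc0.ge
      hcpos (by obtain ⟨a, ha⟩ := ho; omega) (by omega) (fun _ => hc0)
    refine ⟨x, y, _, by positivity, ?_, h⟩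
    have hI : P (s + 1) = ∑ i ∈ Finset.Icc 1 s, (r : ℚ) ^ i + 1 := by
      simp only [P]
      rw [Finset.sum_range_succ', pow_zero, Finset.range_eq_Ico,
        Finset.sum_Ico_add' (fun i => (r : ℚ) ^ i)]
      rfl
    have hden : (r : ℚ) ^ (s + 1) + 2 * ∑ i ∈ Finset.Icc 1 s, (r : ℚ) ^ i + 1 =
        (r + 1) * P (s + 1) := by linarith
    rw [rateBound, if_neg (Nat.not_even_iff_odd.2 ho), ← hs, hden]
    have h1 : (0 : ℚ) < P (s + 1) := by linarith
    have h3 : ((r : ℚ) + 1) / 2 + 1 / (2 * c (s + 1)) = P (s + 1) / c (s + 1) := by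
      field_simp
      linarith
    have h4 : (r : ℚ) ^ (s + 1) = (r + 1) * (P (s + 1) - c (s + 1)) := by linarith
    rw [h3, one_div_div, h4, mul_div_mul_left _ _ hr0, sub_div, div_self h1.ne']

/-! ### From codes to hypergraphs -/

section Bound

variable {ι F : Type*} [Field F]

/-- In a code that recovers sequentially from `t` erasures with locality `r`, any `k ≤ t` columns
of a matrix whose rows span the dual codewords of weight at most `r + 1` have nonzero entries in at
least `k` rows. -/
theorem IsSLR.card_le_card_biUnion [Fintype ι] {C : Submodule F (ι → F)} {r t : ℕ}
    (hC : IsSLR C r t) {κ : Type*} [Fintype κ] (b : κ → ι → F)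
    (hb : ∀ h : ι → F, (Finset.univ.filter fun e => h e ≠ 0).card ≤ r + 1 →
      (∀ c ∈ C, ∑ e, h e * c e = 0) → h ∈ Submodule.span F (Set.range b))
    (T : Finset ι) (hT : T.card ≤ t) :
    T.card ≤ (T.biUnion fun e => Finset.univ.filter fun j => b j e ≠ 0).card := by
  by_contra hlt
  set Q := T.biUnion fun e => Finset.univ.filter fun j => b j e ≠ 0 with hQ
  -- With fewer rows than columns there is a nonzero vector `c` supported in `T` that is orthogonal
  -- to all `b j`, hence to all light dual words.
  let f : (T → F) →ₗ[F] (Q → F) := Matrix.mulVecLin (fun j e => b j.1 e.1)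
  obtain ⟨z, hz, hz0⟩ := Submodule.exists_mem_ne_zero_of_ne_bot
    (LinearMap.ker_ne_bot_of_finrank_lt (f := f) (by
      rw [Module.finrank_fintype_fun_eq_card, Module.finrank_fintype_fun_eq_card,
        Fintype.card_coe, Fintype.card_coe]
      omega))
  let c : ι → F := fun e => if h : e ∈ T then z ⟨e, h⟩ else 0
  have hcz : ∀ e : T, c e.1 = z e := fun e => dif_pos e.2
  have hbc : ∀ j, ∑ e, b j e * c e = 0 := by
    intro j
    have h1 : ∑ e, b j e * c e = ∑ e ∈ T, b j e * c e := by
      symm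
      refine Finset.sum_subset (Finset.subset_univ _) fun e _ he => ?_
      simp [c, he]
    rw [h1]
    by_cases hj : j ∈ Q
    · have h2 : f z ⟨j, hj⟩ = 0 := by
        rw [LinearMap.mem_ker.1 hz]
        rfl
      rw [← Finset.sum_coe_sort T, ← h2]
      exact Finset.sum_congr rfl fun e _ => by rw [hcz]
    · refine Finset.sum_eq_zero fun e he => ?_
      have h2 : b j e = 0 := by
        by_contra h2
        exact hj (Finset.mem_biUnion.2 ⟨e, he, by simpa using h2⟩)
      rw [h2, zero_mul]
  have hspan : ∀ h ∈ Submodule.span F (Set.range b), ∑ e, h e * c e = 0 := by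
    intro h hh
    induction hh using Submodule.span_induction with
    | mem x hx =>
      obtain ⟨j, rfl⟩ := hx
      exact hbc j
    | zero => simp
    | add x y _ _ hx hy => simp [add_mul, Finset.sum_add_distrib, hx, hy]
    | smul a x _ hx => simp [mul_assoc, ← Finset.mul_sum, hx]
  let S := Finset.univ.filter fun e => c e ≠ 0
  have hS : S.Nonempty := by
    by_contra hS
    rw [Finset.not_nonempty_iff_eq_empty, Finset.filter_eq_empty_iff] at hS
    refine hz0 (funext fun e => ?_)
    rw [← hcz]
    simpa using hS (Finset.mem_univ e.1)
  have hST : S ⊆ T := by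
    intro e he
    by_contra heT
    exact (Finset.mem_filter.1 he).2 (dif_neg heT)
  obtain ⟨i, hi, R, hR, hRS, u, hu⟩ := hC.exists_mem hS ((Finset.card_le_card hST).trans hT)
  -- Recovery of a symbol `i` in the support of `c` gives a dual word of weight at most `r + 1` that
  -- meets this support only in `i`, so it is not orthogonal to `c`.
  have hsum : ∀ c' : ι → F, ∑ e, ((if e = i then 1 else 0) - (if e ∈ R then u e else 0)) * c' e =
      c' i - ∑ e ∈ R, u e * c' e := by
    intro c'
    simp [sub_mul, Finset.sum_sub_distrib]
  have h1 := hspan _ (hb (fun e => (if e = i then 1 else 0) - (if e ∈ R then u e else 0)) ?_ ?_)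
  · rw [hsum, Finset.sum_eq_zero, sub_zero] at h1
    · exact (Finset.mem_filter.1 hi).2 h1
    · intro e he
      have h2 : c e = 0 := by
        by_contra h2
        exact Finset.disjoint_left.1 hRS he (Finset.mem_filter.2 ⟨Finset.mem_univ _, h2⟩)
      rw [h2, mul_zero]
  · refine (Finset.card_le_card ?_).trans ((Finset.card_insert_le i R).trans (by omega))
    intro e he
    by_contra h2
    rw [Finset.mem_insert, not_or] at h2
    simp [h2.1, h2.2] at he
  · intro c' hc'
    rw [hsum, hu c' hc', sub_self]

/-- The rate bound for codes with sequential recovery. -/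
theorem IsSLR.codeRate_le [Finite F] [Finite ι] [Nonempty ι] {C : Submodule F (ι → F)} {r t : ℕ}
    (hr : 3 ≤ r) (ht : 1 ≤ t) (hC : IsSLR C r t) : codeRate C ≤ rateBound r t := by
  let _ := Fintype.ofFinite ι
  -- A basis of the span of the light dual words is chosen among these words, so that every row
  -- still has weight at most `r + 1`. This bounds the vertex degrees in the hypergraph.
  let B : Set (ι → F) := {h | (Finset.univ.filter fun e => h e ≠ 0).card ≤ r + 1 ∧
    ∀ c ∈ C, ∑ e, h e * c e = 0}
  obtain ⟨b, hbB, hspan, hli⟩ := exists_linearIndependent F B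
  let _ := Fintype.ofFinite b
  have hall := fun T hT => hC.card_le_card_biUnion (fun h : b => h.1) (fun h h1 h2 => by
    rw [Subtype.range_coe, hspan]
    exact Submodule.subset_span ⟨h1, h2⟩) T hT
  obtain ⟨x, y, M, hM, hrate, h1, h2, h3, h4, h5, h6, h7⟩ := exists_weights hr ht
  have hcard := card_le_of_discharging (fun e => Finset.univ.filter fun h : b => h.1 e ≠ 0) ht
    (fun h => by simpa using (hbB h.2).1) hall x y M h1 h2 h3 h4 h5 h6 h7
  let H : Matrix b ι F := fun h e => h.1 e
  have hrank := finrank_parityCheckCode_add_card (H := H) hli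
  have hle : C ≤ parityCheckCode H := fun c hc => mem_parityCheckCode.2 fun h => (hbB h.2).2 c hc
  have hfin := Submodule.finrank_mono hle
  rw [Nat.card_eq_fintype_card, Nat.card_eq_fintype_card] at hrank
  rw [codeRate, hrate, Nat.card_eq_fintype_card]
  have hn : (0 : ℚ) < Fintype.card ι := by exact_mod_cast Fintype.card_pos
  have h8 : (Module.finrank F C : ℚ) + Fintype.card b ≤ Fintype.card ι := by
    exact_mod_cast (by omega : Module.finrank F C + Fintype.card b ≤ Fintype.card ι)
  have h9 : (Fintype.card ι : ℚ) / M ≤ Fintype.card b := (div_le_iff₀ hM).2 hcard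
  rw [div_le_iff₀ hn, sub_mul, one_mul, one_div_mul_eq_div]
  linarith

end Bound

/-! ### Tree-like graphs with a proper edge colouring -/

namespace Graph

/-- The graph on the vertex set `U` in which the edge `e` has the ends `p e` and `q e`. -/
def ofEnds {α β : Type*} (U : Set α) (p q : β → α) (hp : ∀ e, p e ∈ U) (hq : ∀ e, q e ∈ U) :
    Graph α β where
  vertexSet := U
  IsLink e x y := (x = p e ∧ y = q e) ∨ (x = q e ∧ y = p e)
  isLink_symm := fun _ _ => ⟨fun _ _ h => h.symm.imp And.symm And.symm⟩
  eq_or_eq_of_isLink_of_isLink := by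
    rintro e x y v w (⟨rfl, rfl⟩ | ⟨rfl, rfl⟩) (⟨rfl, rfl⟩ | ⟨rfl, rfl⟩) <;> simp
  left_mem_of_isLink := by
    rintro e x y (⟨rfl, rfl⟩ | ⟨rfl, rfl⟩)
    exacts [hp e, hq e]

theorem ofEnds_inc {α β : Type*} {U : Set α} {p q : β → α} {hp : ∀ e, p e ∈ U}
    {hq : ∀ e, q e ∈ U} {e : β} {v : α} : (ofEnds U p q hp hq).Inc e v ↔ v = p e ∨ v = q e := by
  constructor
  · rintro ⟨w, h | h⟩
    exacts [Or.inl h.1, Or.inr h.1]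
  · rintro (h | h)
    exacts [⟨_, Or.inl ⟨h, rfl⟩⟩, ⟨_, Or.inr ⟨h, rfl⟩⟩]

/-- Words of length at most `s` in the nonzero elements of `C`. -/
abbrev Word (C : Type*) [Zero C] (s : ℕ) : Type _ := {d : List {x : C // x ≠ 0} // d.length ≤ s}

namespace Word

variable {C : Type*} {s : ℕ}

instance [Zero C] [Finite C] : Finite (Word C s) := (List.finite_length_le _ s).to_subtype

/-- The word without its first letter. -/
def tail [Zero C] (d : Word C s) : Word C s := ⟨d.1.tail, by
  have := d.2
  rw [List.length_tail]
  omega⟩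

/-- The word `x :: d`. -/
def cons [Zero C] (x : {x : C // x ≠ 0}) (d : Word C s) (h : d.1.length < s) : Word C s :=
  ⟨x :: d.1, h⟩

theorem exists_cons_of_ne_nil [Zero C] (d : Word C s) (hd : d.1 ≠ []) :
    ∃ x h, d = cons x d.tail h := by
  obtain ⟨l, hl⟩ := d
  cases l with
  | nil => exact (hd rfl).elim
  | cons x l => exact ⟨x, hl, rfl⟩

/-- The sum of the letters. -/
def sum [AddCommGroup C] (d : Word C s) : C := (d.1.map Subtype.val).sum

theorem sum_cons [AddCommGroup C] (x : {x : C // x ≠ 0}) (d : Word C s) (h : d.1.length < s) :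
    (cons x d h).sum = x.1 + d.sum := by
  simp [sum, cons]

end Word

section TreeGraph

variable {I H C : Type*} [AddCommGroup C] {s : ℕ}

/-- The upper end of the tree edge `z`. If `merge` holds, the vertices of the last level that are
given by the same word are identified. -/
noncomputable def treeTop (merge : Prop) (z : I × Word C s) : Option (Option I × Word C s) :=
  some (if merge ∧ z.2.1.length = s then (none, z.2) else (some z.1, z.2))

/-- The lower end of the tree edge `z`. -/
noncomputable def treeBot (z : I × Word C s) : Option (Option I × Word C s) :=
  if z.2.1 = [] then none else some (some z.1, z.2.tail)

/-- The level of a vertex. -/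
def treeLev (v : Option (Option I × Word C s)) : ℕ := v.elim 0 fun x => x.2.1.length + 1

theorem treeLev_treeTop (merge : Prop) (z : I × Word C s) :
    treeLev (treeTop merge z) = z.2.1.length + 1 := by
  rw [treeTop]
  split_ifs <;> rfl

theorem treeLev_treeBot (z : I × Word C s) : treeLev (treeBot z) = z.2.1.length := by
  rw [treeBot]
  split_ifs with h
  · rw [h]
    rfl
  · obtain ⟨x, h1, h2⟩ := z.2.exists_cons_of_ne_nil h
    conv_rhs => rw [h2]
    rfl

theorem eq_treeTop_iff {merge : Prop} {a : I} {d : Word C s} (h : ¬(merge ∧ d.1.length = s))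
    {z : I × Word C s} : some (some a, d) = treeTop merge z ↔ z = (a, d) := by
  obtain ⟨b, d'⟩ := z
  rw [treeTop, Option.some_inj]
  constructor
  · split_ifs with h1 <;> intro h2
    · simp at h2
    · simp only [Prod.mk.injEq, Option.some.injEq] at h2
      rw [h2.1, h2.2]
  · rintro h1
    obtain ⟨rfl, rfl⟩ := Prod.mk.inj h1
    rw [if_neg h]

theorem eq_treeBot_iff {a : I} {d : Word C s} {z : I × Word C s} :
    some (some a, d) = treeBot z ↔ ∃ x h, z = (a, d.cons x h) := by
  obtain ⟨b, d'⟩ := z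
  rw [treeBot]
  constructor
  · split_ifs with h1 <;> intro h2
    · simp at h2
    · simp only [Option.some.injEq, Prod.mk.injEq] at h2
      obtain ⟨rfl, rfl⟩ := h2
      obtain ⟨x, h3, h4⟩ := d'.exists_cons_of_ne_nil h1
      exact ⟨x, h3, by rw [← h4]⟩
  · rintro ⟨x, h, h1⟩
    obtain ⟨rfl, rfl⟩ := Prod.mk.inj h1
    simp [Word.cons, Word.tail]

theorem eq_treeTop_merge_iff {merge : Prop} (hm : merge) {d : Word C s} (hd : d.1.length = s)
    {z : I × Word C s} : some (none, d) = treeTop merge z ↔ z.2 = d := by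
  rw [treeTop, Option.some_inj]
  constructor
  · split_ifs with h1 <;> intro h2
    · exact (congrArg Prod.snd h2).symm
    · simp at h2
  · rintro rfl
    rw [if_pos ⟨hm, hd⟩]

/-- A forest with `I` trees in which the vertices are given by words, with a root that is joined to
the vertices at the lowest level and additional edges `H` between vertices of the last level. -/
noncomputable def treeGraph (merge : Prop) (hp hq : H → I × Word C s) :
    Graph (Option (Option I × Word C s)) ((I × Word C s) ⊕ H) :=
  ofEnds (insert none (Set.range (treeTop merge)))
    (Sum.elim (treeTop merge) fun h => treeTop merge (hp h))
    (Sum.elim treeBot fun h => treeTop merge (hq h))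
    (by rintro (z | h) <;> exact Set.mem_insert_of_mem _ ⟨_, rfl⟩)
    (by
      rintro (z | h)
      · rcases hz : treeBot z with _ | ⟨_ | a, d⟩
        · exact Or.inl hz
        · rw [treeBot] at hz
          split_ifs at hz
          simp at hz
        · obtain ⟨x, h, h1⟩ := eq_treeBot_iff.1 hz.symm
          refine Set.mem_insert_of_mem _ ⟨(a, d), ?_⟩
          rw [Sum.elim_inl, hz, eq_comm, eq_treeTop_iff (fun h2 => by omega)]
      · exact Set.mem_insert_of_mem _ ⟨_, rfl⟩)

variable {merge : Prop} {hp hq : H → I × Word C s}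

theorem treeGraph_inc {e : (I × Word C s) ⊕ H} {v : Option (Option I × Word C s)} :
    (treeGraph merge hp hq).Inc e v ↔
      v = Sum.elim (treeTop merge) (fun h => treeTop merge (hp h)) e ∨
      v = Sum.elim treeBot (fun h => treeTop merge (hq h)) e := ofEnds_inc

theorem treeGraph_inc_inl_iff {a : I} {d : Word C s} (h : ¬(merge ∧ d.1.length = s))
    {z : I × Word C s} : (treeGraph merge hp hq).Inc (.inl z) (some (some a, d)) ↔
      z = (a, d) ∨ ∃ x h, z = (a, d.cons x h) := by
  rw [treeGraph_inc, Sum.elim_inl, Sum.elim_inl, eq_treeTop_iff h, eq_treeBot_iff]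

theorem treeGraph_inc_inr_iff {a : I} {d : Word C s} (h : ¬(merge ∧ d.1.length = s))
    {f : H} : (treeGraph merge hp hq).Inc (.inr f) (some (some a, d)) ↔
      hp f = (a, d) ∨ hq f = (a, d) := by
  rw [treeGraph_inc, Sum.elim_inr, Sum.elim_inr, eq_treeTop_iff h, eq_treeTop_iff h]

theorem treeGraph_inc_merge_iff (hm : merge) (hH : IsEmpty H) {d : Word C s}
    (hd : d.1.length = s) {e : (I × Word C s) ⊕ H} :
    (treeGraph merge hp hq).Inc e (some (none, d)) ↔ ∃ a, e = .inl (a, d) := by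
  rcases e with ⟨a, d'⟩ | f
  · rw [treeGraph_inc, Sum.elim_inl, Sum.elim_inl, eq_treeTop_merge_iff hm hd]
    constructor
    · rintro (h | h)
      · exact ⟨a, by rw [← h]⟩
      · rw [treeBot] at h
        split_ifs at h
        simp at h
    · rintro ⟨b, h⟩
      exact Or.inl (congrArg Prod.snd (Sum.inl_injective h))
  · exact hH.elim f

theorem mem_treeGraph {v : Option (Option I × Word C s)} (hv : v ∈ V(treeGraph merge hp hq))
    (hv0 : v ≠ none) : (∃ a d, v = some (some a, d) ∧ ¬(merge ∧ d.1.length = s)) ∨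
      ∃ d, v = some (none, d) ∧ merge ∧ d.1.length = s := by
  rcases hv with hv | ⟨⟨a, d⟩, rfl⟩
  · exact (hv0 hv).elim
  · rw [treeTop]
    split_ifs with h
    · exact Or.inr ⟨d, rfl, h⟩
    · exact Or.inl ⟨a, d, rfl, h⟩

/-- A vertex that is not merged has one tree edge down and either `r` tree edges that prepend a
letter to its word or, in the last level, `r` edges from `H`. A merged vertex has one edge from each
tree, whence `Nat.card I = r + 1`. -/
theorem deg_treeGraph [Finite I] [Finite H] [Finite C] {r : ℕ}
    (hC : Nat.card {x : C // x ≠ 0} = r)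
    (hps : ∀ h, (hp h).2.1.length = s) (hqs : ∀ h, (hq h).2.1.length = s)
    (hdegH : ¬merge → ∀ z : I × Word C s, z.2.1.length = s → {h | hp h = z ∨ hq h = z}.ncard = r)
    (hm : merge → IsEmpty H ∧ Nat.card I = r + 1)
    {v : Option (Option I × Word C s)} (hv : v ∈ V(treeGraph merge hp hq)) (hv0 : v ≠ none) :
    (treeGraph merge hp hq).deg v = r + 1 := by
  rw [deg]
  rcases mem_treeGraph hv hv0 with ⟨a, d, rfl, h⟩ | ⟨d, rfl, h, hd⟩
  · by_cases hd : d.1.length = s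
    · have hset : {e | (treeGraph merge hp hq).Inc e (some (some a, d))} =
          insert (.inl (a, d)) (Sum.inr '' {f | hp f = (a, d) ∨ hq f = (a, d)}) := by
        ext e
        rcases e with z | f
        · rw [Set.mem_ofPred_eq, treeGraph_inc_inl_iff h]
          simp only [Set.mem_insert_iff, Sum.inl.injEq, Set.mem_image, reduceCtorEq, and_false,
            exists_false, or_false, or_iff_left_iff_imp]
          rintro ⟨x, h1, -⟩
          omega
        · rw [Set.mem_ofPred_eq, treeGraph_inc_inr_iff h]
          simp
      rw [hset, Set.ncard_insert_of_notMem (by simp), Set.ncard_image_of_injective _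
        Sum.inr_injective, hdegH (fun hm => h ⟨hm, hd⟩) (a, d) hd]
    · have hlt : d.1.length < s := lt_of_le_of_ne d.2 hd
      have hset : {e | (treeGraph merge hp hq).Inc e (some (some a, d))} =
          insert (.inl (a, d)) (Set.range fun x => .inl (a, d.cons x hlt)) := by
        ext e
        rcases e with z | f
        · rw [Set.mem_ofPred_eq, treeGraph_inc_inl_iff h]
          simp only [Set.mem_insert_iff, Sum.inl.injEq, Set.mem_range]
          refine or_congr_right ⟨?_, ?_⟩
          · rintro ⟨x, -, rfl⟩
            exact ⟨x, rfl⟩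
          · rintro ⟨x, rfl⟩
            exact ⟨x, hlt, rfl⟩
        · rw [Set.mem_ofPred_eq, treeGraph_inc_inr_iff h]
          simp only [Set.mem_insert_iff, Set.mem_range, reduceCtorEq, exists_false, or_false,
            iff_false, not_or]
          constructor <;> intro h1
          · exact hd (by simpa [h1] using hps f)
          · exact hd (by simpa [h1] using hqs f)
      rw [hset, Set.ncard_insert_of_notMem, Set.ncard_range_of_injective, hC]
      · intro x y hxy
        simpa [Word.cons] using hxy
      · rintro ⟨x, hx⟩
        simp only [Sum.inl.injEq, Prod.mk.injEq, true_and] at hx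
        simpa [Word.cons] using congrArg (fun d : Word C s => d.1.length) hx
  · obtain ⟨hH, hI⟩ := hm h
    have hset : {e | (treeGraph merge hp hq).Inc e (some (none, d))} =
        Set.range fun a => .inl (a, d) := by
      ext e
      rw [Set.mem_ofPred_eq, treeGraph_inc_merge_iff h hH hd]
      simp [eq_comm]
    rw [hset, Set.ncard_range_of_injective, hI]
    intro a b hab
    simpa using hab

theorem isTreeLike_treeGraph [Finite I] [Finite H] [Finite C] {r t : ℕ}
    (hst : s = (t - 1) / 2) (hmt : merge ↔ Odd t)
    (hC : Nat.card {x : C // x ≠ 0} = r)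
    (hps : ∀ h, (hp h).2.1.length = s) (hqs : ∀ h, (hq h).2.1.length = s)
    (hpq : ∀ h h', hp h ≠ hq h')
    (hdegH : ¬merge → ∀ z : I × Word C s, z.2.1.length = s → {h | hp h = z ∨ hq h = z}.ncard = r)
    (hm : merge → IsEmpty H ∧ Nat.card I = r + 1) :
    (treeGraph merge hp hq).IsTreeLike r t (Nat.card I) none treeLev where
  root_mem := Set.mem_insert _ _
  lev_eq_zero := by
    rintro (_ | v) _
    · exact iff_of_true rfl rfl
    · exact iff_of_false (Nat.succ_ne_zero _) (by simp)
  lev_le := by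
    rw [← hst]
    rintro (_ | v) _
    · exact Nat.zero_le _
    · exact Nat.succ_le_succ v.2.2
  deg_root := by
    have hset : {e | (treeGraph merge hp hq).Inc e none} =
        Set.range fun a => .inl (a, ⟨[], Nat.zero_le _⟩) := by
      ext e
      rw [Set.mem_ofPred_eq, treeGraph_inc]
      rcases e with ⟨a, d, hd⟩ | f
      · simp only [Sum.elim_inl, treeTop, treeBot, reduceCtorEq, false_or, Set.mem_range,
          Sum.inl.injEq, Prod.mk.injEq, exists_eq_left, Subtype.mk.injEq]
        split_ifs with h
        · simp [h]
        · simpa [eq_comm] using h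
      · simp [treeTop]
    rw [deg, hset, Set.ncard_range_of_injective]
    intro a b hab
    simpa using hab
  deg_eq := fun v hv hv0 => deg_treeGraph hC hps hqs hdegH hm hv hv0
  isLink := by
    rintro (z | f) x y (⟨rfl, rfl⟩ | ⟨rfl, rfl⟩)
    · exact Or.inr (Or.inl (by rw [Sum.elim_inl, Sum.elim_inl, treeLev_treeTop, treeLev_treeBot]))
    · exact Or.inl (by rw [Sum.elim_inl, Sum.elim_inl, treeLev_treeTop, treeLev_treeBot])
    all_goals
      have hmf : ¬merge := fun h => (hm h).1.elim f
      have ht : Even t := by rwa [hmt, Nat.not_odd_iff_even] at hmf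
      have hne : treeTop merge (hp f) ≠ treeTop merge (hq f) := by
        intro h
        have h1 : treeTop merge (hp f) = some (some (hp f).1, (hp f).2) := by
          rw [treeTop, if_neg fun h => hmf h.1]
        rw [h1, eq_treeTop_iff fun h => hmf h.1] at h
        exact hpq f f h.symm
      refine Or.inr (Or.inr ⟨ht, ?_, ?_, ?_⟩)
      · rw [Sum.elim_inr, treeLev_treeTop, ← hst]
        simp only [hps, hqs]
      · rw [Sum.elim_inr, treeLev_treeTop, ← hst]
        simp only [hps, hqs]
      · first | exact hne | exact hne.symm
  existsUnique_down := by
    intro v hv hv0 hodd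
    rcases mem_treeGraph hv hv0 with ⟨a, d, rfl, h⟩ | ⟨d, rfl, h, hd⟩
    · refine ⟨.inl (a, d), ⟨treeBot (a, d), Or.inl ⟨(eq_treeTop_iff h).2 rfl, rfl⟩, ?_⟩, ?_⟩
      · rw [treeLev_treeBot]
        exact Nat.lt_succ_self _
      · rintro (z | f) ⟨u, ⟨h1, rfl⟩ | ⟨h1, rfl⟩, hlt⟩
        · rw [Sum.elim_inl, eq_treeTop_iff h] at h1
          rw [h1]
        · rw [h1, Sum.elim_inl, Sum.elim_inl, treeLev_treeTop, treeLev_treeBot] at hlt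
          omega
        · rw [h1, Sum.elim_inr, Sum.elim_inr, treeLev_treeTop, treeLev_treeTop, hps, hqs] at hlt
          omega
        · rw [h1, Sum.elim_inr, Sum.elim_inr, treeLev_treeTop, treeLev_treeTop, hps, hqs] at hlt
          omega
    · have h1 := hodd (hmt.1 h)
      have h2 : treeLev (some ((none : Option I), d)) = d.1.length + 1 := rfl
      omega

/-- The colouring of the edges of `treeGraph`. -/
def treeColour (letter : I → C) (hcol : H → C) : (I × Word C s) ⊕ H → C :=
  Sum.elim (fun z => letter z.1 + z.2.sum) hcol

/-- At the vertex given by `a` and `d` the tree edge down has the colour `letter a + d.sum`, and the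
edges up differ from it by the distinct nonzero letters `x`. At a merged vertex the colours `letter
a + d.sum` differ because `letter` is injective. -/
theorem treeColour_injOn {letter : I → C} {hcol : H → C}
    (hps : ∀ h, (hp h).2.1.length = s) (hqs : ∀ h, (hq h).2.1.length = s)
    (hm : merge → IsEmpty H ∧ Function.Injective letter)
    (hcolne : ∀ h z, hp h = z ∨ hq h = z → hcol h ≠ letter z.1 + z.2.sum)
    (hcolinj : ∀ h h' z, hp h = z ∨ hq h = z → hp h' = z ∨ hq h' = z → hcol h = hcol h' → h = h')
    {v : Option (Option I × Word C s)} (hv : v ∈ V(treeGraph merge hp hq)) (hv0 : v ≠ none) :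
    Set.InjOn (treeColour letter hcol) {e | (treeGraph merge hp hq).Inc e v} := by
  intro e he f hf hef
  rw [Set.mem_ofPred_eq] at he hf
  rcases mem_treeGraph hv hv0 with ⟨a, d, rfl, h⟩ | ⟨d, rfl, h, hd⟩
  · have hlast : ∀ g, (treeGraph merge hp hq).Inc (.inr g) (some (some a, d)) →
        d.1.length = s := by
      intro g hg
      rcases (treeGraph_inc_inr_iff h).1 hg with h1 | h1
      · simpa [h1] using hps g
      · simpa [h1] using hqs g
    rcases e with z | e <;> rcases f with z' | f
    · rw [treeGraph_inc_inl_iff h] at he hf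
      simp only [treeColour, Sum.elim_inl] at hef
      rcases he with rfl | ⟨x, hx, rfl⟩ <;> rcases hf with rfl | ⟨x', hx', rfl⟩
      · rfl
      · rw [Word.sum_cons, add_right_inj, right_eq_add] at hef
        exact (x'.2 hef).elim
      · rw [Word.sum_cons, add_right_inj, add_eq_right] at hef
        exact (x.2 hef).elim
      · rw [Word.sum_cons, Word.sum_cons, add_right_inj, add_left_inj] at hef
        rw [Subtype.ext hef]
    · have hd := hlast f hf
      rw [treeGraph_inc_inl_iff h] at he
      rw [treeGraph_inc_inr_iff h] at hf
      rcases he with rfl | ⟨x, hx, rfl⟩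
      · exact (hcolne f _ hf hef.symm).elim
      · omega
    · have hd := hlast e he
      rw [treeGraph_inc_inl_iff h] at hf
      rw [treeGraph_inc_inr_iff h] at he
      rcases hf with rfl | ⟨x, hx, rfl⟩
      · exact (hcolne e _ he hef).elim
      · omega
    · rw [treeGraph_inc_inr_iff h] at he hf
      rw [hcolinj e f _ he hf hef]
  · obtain ⟨hH, hinj⟩ := hm h
    obtain ⟨a, rfl⟩ := (treeGraph_inc_merge_iff h hH hd).1 he
    obtain ⟨b, rfl⟩ := (treeGraph_inc_merge_iff h hH hd).1 hf
    simp only [treeColour, Sum.elim_inl, add_left_inj] at hef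
    rw [hinj hef]

theorem isProperEdgeColouring_treeGraph {letter : I → C} {hcol : H → C}
    (hps : ∀ h, (hp h).2.1.length = s) (hqs : ∀ h, (hq h).2.1.length = s)
    (hm : merge → IsEmpty H ∧ Function.Injective letter)
    (hcolne : ∀ h z, hp h = z ∨ hq h = z → hcol h ≠ letter z.1 + z.2.sum)
    (hcolinj : ∀ h h' z, hp h = z ∨ hq h = z → hp h' = z ∨ hq h' = z → hcol h = hcol h' → h = h') :
    ((treeGraph merge hp hq).base none).IsProperEdgeColouring (treeColour letter hcol) := by
  rintro v e f ⟨w, hw⟩ ⟨w', hw'⟩ hef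
  rw [base_isLink] at hw hw'
  exact treeColour_injOn hps hqs hm hcolne hcolinj hw.1.left_mem hw.2.1 hw.1.inc_left
    hw'.1.inc_left hef

/-- The condition `1 ≤ s` in the merged case cannot be dropped: for `s = 0` all trees share one
vertex, which is joined to the root by an edge for each tree. -/
theorem simple_treeGraph [(treeGraph merge hp hq).Loopless]
    (hm : merge → IsEmpty H ∧ 1 ≤ s)
    (hpq : ∀ h h', hp h ≠ hq h')
    (hinj : ∀ h h', hp h = hp h' → hq h = hq h' → h = h')
    (hps : ∀ h, (hp h).2.1.length = s) (hqs : ∀ h, (hq h).2.1.length = s) :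
    (treeGraph merge hp hq).Simple where
  eq_of_isLink := by
    have hinl : ∀ z z' : I × Word C s, treeTop merge z = treeTop merge z' →
        treeBot z = treeBot z' → z = z' := by
      rintro ⟨a, d⟩ ⟨a', d'⟩ h1 h2
      have hd : d = d' := by
        have := congrArg (Option.map Prod.snd) h1
        rw [treeTop, treeTop] at this
        split_ifs at this <;> simpa using this
      subst hd
      by_cases h3 : merge ∧ d.1.length = s
      · have h4 : d.1 ≠ [] := fun h4 => by
          have := (hm h3.1).2
          rw [← h3.2, h4] at this
          simp at this
        rw [treeBot, treeBot, if_neg h4, if_neg h4] at h2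
        simpa using h2
      · rw [treeTop, if_neg h3] at h1
        exact ((eq_treeTop_iff h3).1 h1).symm
    have htop : ∀ f g, ∀ z : H → I × Word C s, treeTop merge (z f) = treeTop merge g → z f = g := by
      intro f g z h
      have hmf : ¬merge := fun h => (hm h).1.elim f
      rw [treeTop, if_neg fun h => hmf h.1] at h
      exact ((eq_treeTop_iff fun h => hmf h.1).1 h).symm
    have key : ∀ e f x y, (treeGraph merge hp hq).IsLink e x y →
        Sum.elim (treeTop merge) (fun h => treeTop merge (hp h)) f = x →
        Sum.elim treeBot (fun h => treeTop merge (hq h)) f = y → e = f := by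
      rintro (z | e) (z' | f) x y (⟨rfl, rfl⟩ | ⟨rfl, rfl⟩) h1 h2 <;>
        simp only [Sum.elim_inl, Sum.elim_inr] at h1 h2
      · rw [hinl _ _ h1 h2]
      · have h3 := congrArg treeLev h1
        have h4 := congrArg treeLev h2
        rw [treeLev_treeTop, treeLev_treeBot] at h3 h4
        omega
      · have h3 := congrArg treeLev h1
        have h4 := congrArg treeLev h2
        simp only [treeLev_treeTop, treeLev_treeBot, hps, hqs] at h3 h4
        omega
      · have h3 := congrArg treeLev h1
        have h4 := congrArg treeLev h2
        simp only [treeLev_treeTop, treeLev_treeBot, hps, hqs] at h3 h4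
        omega
      · have h3 := congrArg treeLev h1
        have h4 := congrArg treeLev h2
        simp only [treeLev_treeTop, treeLev_treeBot, hps, hqs] at h3 h4
        omega
      · have h3 := congrArg treeLev h1
        have h4 := congrArg treeLev h2
        simp only [treeLev_treeTop, treeLev_treeBot, hps, hqs] at h3 h4
        omega
      · rw [hinj _ _ (htop _ _ hp h1) (htop _ _ hq h2)]
      · exact (hpq _ _ (htop _ _ hp h1)).elim
    rintro e f x y he (⟨h1, h2⟩ | ⟨h1, h2⟩)
    · exact key e f x y he h1.symm h2.symm
    · exact key e f y x he.symm h2.symm h1.symm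

end TreeGraph

end Graph

/-! ### Existence of coloured tree-like graphs -/

/-- Disjoint permutations: if the fibres of `σ : X → C` are not smaller than `C` without one
element, then every `j : C` has a permutation `π j` of `X` that preserves the fibres, such that, on
the fibre of `c`, the permutations `π j`, `j ≠ c`, differ from each other everywhere. -/
theorem exists_disjoint_perm {X C : Type*} [Finite X] [Finite C] (σ : X → C)
    (hσ : ∀ x, Nat.card {j // j ≠ σ x} ≤ Nat.card {y // σ y = σ x}) :
    ∃ π : C → Equiv.Perm X, (∀ j x, σ (π j x) = σ x) ∧
      ∀ j j' x, j ≠ σ x → j' ≠ σ x → π j x = π j' x → j = j' := by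
  have hfib : ∀ c, ∃ ρ : C → Equiv.Perm {y // σ y = c},
      ∀ j j' y, j ≠ c → j' ≠ c → ρ j y = ρ j' y → j = j' := by
    intro c
    rcases isEmpty_or_nonempty {y // σ y = c} with hY | ⟨⟨x, rfl⟩⟩
    · exact ⟨fun _ => 1, fun _ _ y => (hY.false y).elim⟩
    · set Y := {y // σ y = σ x}
      have : NeZero (Nat.card Y) := ⟨(Nat.card_pos_iff.2 ⟨⟨⟨x, rfl⟩⟩, inferInstance⟩).ne'⟩
      let e : Y ≃ ZMod (Nat.card Y) := (Finite.equivFin Y).trans (ZMod.finEquiv _).toEquiv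
      obtain ⟨g⟩ : Nonempty ({j // j ≠ σ x} ↪ ZMod (Nat.card Y)) := by
        let _ := Fintype.ofFinite {j // j ≠ σ x}
        rw [Function.Embedding.nonempty_iff_card_le, ← Nat.card_eq_fintype_card,
          ← Nat.card_eq_fintype_card, Nat.card_zmod]
        exact hσ x
      -- The fibre is identified with a cyclic group; translations by different elements agree
      -- nowhere.
      refine ⟨fun j => if h : j ≠ σ x then (e.trans (Equiv.addRight (g ⟨j, h⟩))).trans e.symm else 1,
        fun j j' y hj hj' h => ?_⟩
      dsimp only at h
      rw [dif_pos hj, dif_pos hj'] at h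
      simp only [Equiv.trans_apply, EmbeddingLike.apply_eq_iff_eq, Equiv.coe_addRight,
        add_right_inj] at h
      exact congrArg Subtype.val h
  choose ρ hρ using hfib
  refine ⟨fun j => (Equiv.sigmaFiberEquiv σ).symm.trans
    ((Equiv.sigmaCongrRight fun c => ρ c j).trans (Equiv.sigmaFiberEquiv σ)),
    fun j x => (ρ (σ x) j ⟨x, rfl⟩).2, fun j j' x hj hj' h => ?_⟩
  exact hρ (σ x) j j' ⟨x, rfl⟩ hj hj' (Subtype.ext h)

namespace Graph

theorem card_ne_fin (r : ℕ) (a : Fin (r + 1)) : Nat.card {x : Fin (r + 1) // x ≠ a} = r := by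
  rw [Nat.card_eq_fintype_card, Fintype.card_subtype_compl, Fintype.card_fin,
    Fintype.card_subtype_eq, Nat.add_sub_cancel]

/-- One tree for each colour, with the last levels of all trees identified. -/
theorem exists_isTreeLike_of_odd {r t : ℕ} (ht : Odd t) :
    ∃ (V E : Type) (_ : Finite V) (_ : Finite E) (G : Graph V E) (root : V) (lev : V → ℕ)
      (cB : E → Fin (r + 1)), G.IsTreeLike r t (r + 1) root lev ∧
      (G.base root).IsProperEdgeColouring cB ∧ (2 ≤ t → G.Simple) := by
  let hp : Empty → Fin (r + 1) × Word (Fin (r + 1)) ((t - 1) / 2) := fun h => h.elim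
  have htree := isTreeLike_treeGraph (merge := True) (hp := hp) (hq := hp) (r := r) (t := t)
    rfl (by simpa using ht) (card_ne_fin r 0) (fun h => h.elim) (fun h => h.elim)
    (fun h => h.elim) (fun h => (h trivial).elim) (fun _ => ⟨inferInstance, Nat.card_fin _⟩)
  rw [Nat.card_fin] at htree
  refine ⟨_, _, inferInstance, inferInstance, treeGraph True hp hp, none, treeLev,
    treeColour id (fun h => h.elim), htree, ?_, fun h2 => ?_⟩
  · exact isProperEdgeColouring_treeGraph (fun h => h.elim) (fun h => h.elim)
      (fun _ => ⟨inferInstance, Function.injective_id⟩) (fun h => h.elim) (fun h => h.elim)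
  · have := htree.loopless
    refine simple_treeGraph (fun _ => ⟨inferInstance, ?_⟩) (fun h => h.elim)
      (fun h => h.elim) (fun h => h.elim) (fun h => h.elim)
    obtain ⟨a, ha⟩ := ht
    omega

/-- Two families of `K` trees are joined by a bipartite graph between their last levels. A
last-level vertex `x` needs an edge of each colour except `σ x`, the colour of its edge down. The
colour `j` is realised by joining `x` to `π j x` on the other side, which has the same missing
colour; `hK` makes the fibres of `σ` large enough for these matchings to be disjoint. -/
theorem exists_isTreeLike_of_even_aux {r t : ℕ} (ht : Even t) (K : Type) [Finite K]
    (hK : ∀ d : Word (Fin (r + 1)) ((t - 1) / 2), d.1.length = (t - 1) / 2 →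
      r ≤ Nat.card {x : K × {d : Word (Fin (r + 1)) ((t - 1) / 2) // d.1.length = (t - 1) / 2} //
        x.2.1.sum = d.sum}) :
    ∃ (V E : Type) (_ : Finite V) (_ : Finite E) (G : Graph V E) (root : V) (lev : V → ℕ)
      (cB : E → Fin (r + 1)), G.IsTreeLike r t (2 * Nat.card K) root lev ∧
      (G.base root).IsProperEdgeColouring cB ∧ G.Simple := by
  set s := (t - 1) / 2 with hs
  let X := K × {d : Word (Fin (r + 1)) s // d.1.length = s}
  let σ : X → Fin (r + 1) := fun x => x.2.1.sum
  obtain ⟨π, hπσ, hπ⟩ := exists_disjoint_perm σ (fun x => by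
    rw [card_ne_fin]
    exact hK x.2.1 x.2.2)
  let H := {y : X × Fin (r + 1) // y.2 ≠ σ y.1}
  let emb : Bool → X → (Bool × K) × Word (Fin (r + 1)) s := fun b x => ((b, x.1), x.2.1)
  have hemb : ∀ b x b' x', emb b x = emb b' x' ↔ b = b' ∧ x = x' := by
    rintro b ⟨k, d, hd⟩ b' ⟨k', d', hd'⟩
    constructor
    · intro h
      simp only [emb, Prod.mk.injEq] at h
      obtain ⟨⟨rfl, rfl⟩, rfl⟩ := h
      exact ⟨rfl, rfl⟩
    · rintro ⟨rfl, h⟩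
      rw [h]
  have hemb' : ∀ z : (Bool × K) × Word (Fin (r + 1)) s, z.2.1.length = s → ∃ b x, z = emb b x :=
    fun z hz => ⟨z.1.1, (z.1.2, ⟨z.2, hz⟩), rfl⟩
  let hp : H → (Bool × K) × Word (Fin (r + 1)) s := fun y => emb false y.1.1
  let hq : H → (Bool × K) × Word (Fin (r + 1)) s := fun y => emb true (π y.1.2 y.1.1)
  have hps : ∀ h, (hp h).2.1.length = s := fun h => h.1.1.2.2
  have hqs : ∀ h, (hq h).2.1.length = s := fun h => (π h.1.2 h.1.1).2.2
  have hpq : ∀ h h', hp h ≠ hq h' := fun h h' h1 => by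
    simpa using ((hemb _ _ _ _).1 h1).1
  -- An edge within the last level is determined by its colour and one of its ends.
  have hend : ∀ b x (h : H), hp h = emb b x ∨ hq h = emb b x ↔
      (if b then π h.1.2 h.1.1 = x else h.1.1 = x) := by
    intro b x h
    simp only [hp, hq, hemb]
    cases b <;> simp
  have hcolne : ∀ (h : H) z, hp h = z ∨ hq h = z → h.1.2 ≠ 0 + z.2.sum := by
    intro h z hz
    obtain ⟨b, x, rfl⟩ := hemb' z (by rcases hz with rfl | rfl; exacts [hps h, hqs h])
    rw [hend] at hz
    have h1 : σ x = σ h.1.1 := by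
      split_ifs at hz
      · rw [← hz, hπσ]
      · rw [hz]
    rw [zero_add]
    change h.1.2 ≠ σ x
    rw [h1]
    exact h.2
  have hcolinj : ∀ (h h' : H) z, hp h = z ∨ hq h = z → hp h' = z ∨ hq h' = z →
      h.1.2 = h'.1.2 → h = h' := by
    intro h h' z hz hz' hc
    obtain ⟨b, x, rfl⟩ := hemb' z (by rcases hz with rfl | rfl; exacts [hps h, hqs h])
    rw [hend] at hz hz'
    refine Subtype.ext (Prod.ext ?_ hc)
    split_ifs at hz
    · rw [if_pos (by assumption)] at hz'
      rw [hc] at hz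
      exact (π h'.1.2).injective (hz.trans hz'.symm)
    · rw [if_neg (by assumption)] at hz'
      exact hz.trans hz'.symm
  have hdegH : ∀ z : (Bool × K) × Word (Fin (r + 1)) s, z.2.1.length = s →
      {h | hp h = z ∨ hq h = z}.ncard = r := by
    intro z hz
    obtain ⟨b, x, rfl⟩ := hemb' z hz
    rw [← Nat.card_coe_set_eq]
    refine Eq.trans ?_ (card_ne_fin r (σ x))
    refine Nat.card_congr (Equiv.ofBijective (fun h => ⟨h.1.1.2, ?_⟩) ⟨?_, ?_⟩)
    · have := hcolne h.1 _ h.2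
      rwa [zero_add] at this
    · intro h h' hh
      exact Subtype.ext (hcolinj _ _ _ h.2 h'.2 (congrArg Subtype.val hh))
    · rintro ⟨j, hj⟩
      cases b
      · refine ⟨⟨⟨(x, j), hj⟩, ?_⟩, rfl⟩
        rw [Set.mem_ofPred_eq, hend]
        simp
      · refine ⟨⟨⟨((π j).symm x, j), ?_⟩, ?_⟩, rfl⟩
        · have := hπσ j ((π j).symm x)
          rw [Equiv.apply_symm_apply] at this
          rwa [← this]
        · rw [Set.mem_ofPred_eq, hend]
          simp
  have htree := isTreeLike_treeGraph (merge := False) (hp := hp) (hq := hq) (r := r) (t := t)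
    hs (by simpa using ht) (card_ne_fin r 0) hps hqs hpq (fun _ => hdegH) False.elim
  rw [Nat.card_prod, Nat.card_eq_fintype_card (α := Bool), Fintype.card_bool] at htree
  have := htree.loopless
  refine ⟨_, _, inferInstance, inferInstance, treeGraph False hp hq, none, treeLev,
    treeColour (fun _ => 0) (fun h => h.1.2), htree, ?_, ?_⟩
  · exact isProperEdgeColouring_treeGraph hps hqs False.elim hcolne hcolinj
  · refine simple_treeGraph False.elim hpq (fun h h' h1 h2 => ?_) hps hqs
    obtain ⟨⟨x, j⟩, hj⟩ := h
    obtain ⟨⟨x', j'⟩, hj'⟩ := h'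
    obtain rfl : x = x' := ((hemb _ _ _ _).1 h1).2
    obtain rfl : j = j' := hπ j j' x hj hj' ((hemb _ _ _ _).1 h2).2
    rfl

/-- Two copies of the words of length `s ≥ 2` with a given sum are enough. -/
theorem le_card_word_sum_eq {r s : ℕ} (hr : 1 ≤ r) (hs : 2 ≤ s) (d : Word (Fin (r + 1)) s)
    (hd : d.1.length = s) :
    r ≤ Nat.card {x : Fin 2 × {d : Word (Fin (r + 1)) s // d.1.length = s} //
      x.2.1.sum = d.sum} := by
  have h10 : (1 : Fin (r + 1)) ≠ 0 := by
    intro h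
    have := congrArg Fin.val h
    rw [Fin.val_one', Fin.val_zero, Nat.mod_eq_of_lt (by omega)] at this
    omega
  -- The words `c - x, x, 1, …, 1` have the required sum and are admissible unless `x = c`. The
  -- second copy makes up for this one exception.
  let w : List {x : Fin (r + 1) // x ≠ 0} := List.replicate (s - 2) ⟨1, h10⟩
  let c : Fin (r + 1) := d.sum - (w.map Subtype.val).sum
  let word : ∀ x y : {x : Fin (r + 1) // x ≠ 0}, {d : Word (Fin (r + 1)) s // d.1.length = s} :=
    fun x y => ⟨⟨x :: y :: w, by simp [w]; omega⟩, by simp [w]; omega⟩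
  let f : {x : Fin (r + 1) // x ≠ 0} →
      {x : Fin 2 × {d : Word (Fin (r + 1)) s // d.1.length = s} // x.2.1.sum = d.sum} :=
    fun x => if h : c - x.1 ≠ 0 then ⟨(0, word ⟨c - x.1, h⟩ x), by
      simp only [Word.sum, word, List.map_cons, List.sum_cons, c]
      abel⟩ else ⟨(1, ⟨d, hd⟩), rfl⟩
  have hf : Function.Injective f := by
    intro x y hxy
    simp only [f] at hxy
    split_ifs at hxy with h1 h2 h2
    · simp only [word, Subtype.mk.injEq, Prod.mk.injEq, List.cons.injEq] at hxy
      exact hxy.2.2.1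
    · simp at hxy
    · simp at hxy
    · push Not at h1 h2
      exact Subtype.ext ((sub_eq_zero.1 h1).symm.trans (sub_eq_zero.1 h2))
  exact (card_ne_fin r 0).symm.trans_le (Nat.card_le_card_of_injective f hf)

/-- For `6 ≤ t` the words have at least two letters and two trees on each side suffice, so `a₀ = 4`.
Otherwise `r` trees on each side give `r` copies of every word. -/
theorem exists_isTreeLike_of_even {r t : ℕ} (hr : 1 ≤ r) (ht : Even t) :
    ∃ (V E : Type) (_ : Finite V) (_ : Finite E) (G : Graph V E) (root : V) (lev : V → ℕ)
      (a₀ : ℕ) (cB : E → Fin (r + 1)), G.IsTreeLike r t a₀ root lev ∧ 0 < a₀ ∧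
      (G.base root).IsProperEdgeColouring cB ∧ G.Simple ∧ (6 ≤ t → a₀ = 4) := by
  by_cases h6 : 6 ≤ t
  · obtain ⟨V, E, hV, hE, G, root, lev, cB, h1, h2, h3⟩ :=
      exists_isTreeLike_of_even_aux (r := r) ht (Fin 2)
        (fun d hd => le_card_word_sum_eq hr (by omega) d hd)
    rw [Nat.card_fin] at h1
    exact ⟨V, E, hV, hE, G, root, lev, 2 * 2, cB, h1, by omega, h2, h3, fun _ => rfl⟩
  · obtain ⟨V, E, hV, hE, G, root, lev, cB, h1, h2, h3⟩ :=
      exists_isTreeLike_of_even_aux (r := r) ht (Fin r) (fun d hd => by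
        let f : Fin r → {x : Fin r × {d : Word (Fin (r + 1)) ((t - 1) / 2) //
            d.1.length = (t - 1) / 2} // x.2.1.sum = d.sum} := fun k => ⟨(k, ⟨d, hd⟩), rfl⟩
        have hf : Function.Injective f := fun k k' h => by simpa [f] using h
        have := Nat.card_le_card_of_injective f hf
        rwa [Nat.card_fin] at this)
    rw [Nat.card_fin] at h1
    exact ⟨V, E, hV, hE, G, root, lev, _, cB, h1, by omega, h2, h3, fun h => (h6 h).elim⟩

theorem exists_isTreeLike {r : ℕ} (t : ℕ) (hr : 1 ≤ r) :
    ∃ (V E : Type) (_ : Finite V) (_ : Finite E) (G : Graph V E) (root : V) (lev : V → ℕ)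
      (a₀ : ℕ) (cB : E → Fin (r + 1)),
      G.IsTreeLike r t a₀ root lev ∧ 0 < a₀ ∧ (G.base root).IsProperEdgeColouring cB ∧
      (2 ≤ t → G.Simple) ∧ (Odd t → a₀ = r + 1) ∧ (Even t → 6 ≤ t → a₀ = 4) := by
  rcases Nat.even_or_odd t with ht | ht
  · obtain ⟨V, E, hV, hE, G, root, lev, a₀, cB, h1, h2, h3, h4, h5⟩ :=
      exists_isTreeLike_of_even hr ht
    exact ⟨V, E, hV, hE, G, root, lev, a₀, cB, h1, h2, h3, fun _ => h4,
      fun ho => absurd ht (Nat.not_even_iff_odd.2 ho), fun _ => h5⟩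
  · obtain ⟨V, E, hV, hE, G, root, lev, cB, h1, h2, h3⟩ := exists_isTreeLike_of_odd (r := r) ht
    exact ⟨V, E, hV, hE, G, root, lev, r + 1, cB, h1, Nat.succ_pos r, h2, h3, fun _ => rfl,
      fun he => absurd he (Nat.not_even_iff_odd.2 ht)⟩

theorem exists_isTreeLike_le_girth {r t : ℕ} (hr : 1 ≤ r) (ht : 1 ≤ t) :
    ∃ (V E : Type) (_ : Finite V) (_ : Finite E) (G : Graph V E) (root : V) (lev : V → ℕ)
      (a₀ : ℕ), G.IsTreeLike r t a₀ root lev ∧ 0 < a₀ ∧ ((t + 1 : ℕ) : ℕ∞) ≤ G.girth := by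
  obtain ⟨V, E, hV, hE, G, root, lev, a₀, cB, h1, h2, h3, -⟩ := exists_isTreeLike t hr
  obtain ⟨U, D, hU, hD, A, cA, hne, hA⟩ := exists_isAuxiliary r t ht
  exact ⟨_, _, inferInstance, inferInstance, G.expandRoot root A cB cA, none, _, _,
    h1.expandRoot hA.perfectMatching,
    Nat.mul_pos h2 ((Set.ncard_pos).2 hne),
    h1.le_girth_expandRoot h3 hA.perfectMatching hA.le_girth⟩

end Graph

/-! ### The main theorem -/

theorem mainTheorem2 (r t : ℕ) (hr : 3 ≤ r) (ht : 1 ≤ t) :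
    -- Girth criterion, binary codes: the parity-check matrix is the incidence matrix of `G₀`.
    (∀ {V E : Type*} [Finite V] [Finite E] (G : Graph V E) (root : V) (lev : V → ℕ) (a₀ : ℕ),
      G.IsTreeLike r t a₀ root lev →
        (IsSLR (parityCheckCode G.incidenceMatrix) r t ↔ ((t + 1 : ℕ) : ℕ∞) ≤ G.girth) ∧
        (0 < a₀ → codeRate (parityCheckCode G.incidenceMatrix) = rateBound r t)) ∧
    -- Girth criterion over an arbitrary finite field: each node but `root` is a parity check,
    -- with arbitrary nonzero coefficients at its edges.
    (∀ {V E F : Type*} [Finite V] [Finite E] [Field F] [Finite F] (G : Graph V E) (root : V)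
      (lev : V → ℕ) (a₀ : ℕ) (H : Matrix {v // v ∈ V(G) ∧ v ≠ root} E(G) F),
      G.IsTreeLike r t a₀ root lev → (∀ v e, H v e ≠ 0 ↔ G.Inc e.1 v.1) →
        (((t + 1 : ℕ) : ℕ∞) ≤ G.girth → IsSLR (parityCheckCode H) r t) ∧
        (0 < a₀ → codeRate (parityCheckCode H) = rateBound r t)) ∧
    -- The expansion of a properly coloured graph by an auxiliary graph has large girth.
    (∀ {V E U D : Type*} [Finite V] [Finite E] [Finite U] [Finite D] (B : Graph V E)
      (A : Graph U D) (cB : E → Fin (r + 1)) (cA : D → Option (Fin (r + 1))),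
      B.IsProperEdgeColouring cB → A.IsAuxiliary r t cA →
        ((t + 1 : ℕ) : ℕ∞) ≤ (B.expand A cB cA).girth) ∧
    -- If the base graph of `G₀` is properly coloured, its expansion, with a new root, is again a
    -- tree-like graph, now of girth at least `t + 1`.
    (∀ {V E U D : Type*} [Finite V] [Finite E] [Finite U] [Finite D] (G : Graph V E) (root : V)
      (lev : V → ℕ) (a₀ : ℕ) (A : Graph U D) (cB : E → Fin (r + 1))
      (cA : D → Option (Fin (r + 1))),
      G.IsTreeLike r t a₀ root lev → (G.base root).IsProperEdgeColouring cB →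
      A.IsAuxiliary r t cA →
        (G.expandRoot root A cB cA).IsTreeLike r t (a₀ * V(A).ncard) none
          (fun p => p.elim 0 fun x => lev x.1) ∧
        ((t + 1 : ℕ) : ℕ∞) ≤ (G.expandRoot root A cB cA).girth) ∧
    -- Tree-like graphs whose base graph is properly coloured by `r + 1` colours exist.
    (∃ (V E : Type) (_ : Finite V) (_ : Finite E) (G : Graph V E) (root : V) (lev : V → ℕ)
      (a₀ : ℕ) (cB : E → Fin (r + 1)),
      G.IsTreeLike r t a₀ root lev ∧ 0 < a₀ ∧ (G.base root).IsProperEdgeColouring cB ∧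
      (2 ≤ t → G.Simple) ∧ (Odd t → a₀ = r + 1) ∧ (Even t → 6 ≤ t → a₀ = 4)) ∧
    -- Auxiliary graphs exist.
    (∃ (U D : Type) (_ : Finite U) (_ : Finite D) (A : Graph U D)
      (cA : D → Option (Fin (r + 1))), V(A).Nonempty ∧ A.IsAuxiliary r t cA) ∧
    -- The rate bound holds for all S-LR codes over all finite fields …
    (∀ {F ι : Type*} [Field F] [Finite F] [Finite ι] [Nonempty ι] (C : Submodule F (ι → F)),
      IsSLR C r t → codeRate C ≤ rateBound r t) ∧
    -- … and is attained by binary codes that come from a tree-like graph of large girth.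
    (∃ (V E : Type) (_ : Finite V) (_ : Finite E) (G : Graph V E) (root : V) (lev : V → ℕ)
      (a₀ : ℕ),
      G.IsTreeLike r t a₀ root lev ∧ 0 < a₀ ∧ ((t + 1 : ℕ) : ℕ∞) ≤ G.girth ∧
      IsSLR (parityCheckCode G.incidenceMatrix) r t ∧
      codeRate (parityCheckCode G.incidenceMatrix) = rateBound r t) := by
  have hr1 : 1 ≤ r := by omega
  refine ⟨fun G root lev a₀ h => h.incidenceMatrix_code hr1, fun G root lev a₀ H h hH =>
    ⟨isSLR_parityCheckCode_of_le_girth G root H hH fun v hv hvr => (h.deg_eq v hv hvr).le,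
      fun ha => h.codeRate_eq hr1 ha H hH⟩, fun B A cB cA hB hA => le_girth_expand hB hA.le_girth,
    fun G root lev a₀ A cB cA h hB hA => ⟨h.expandRoot hA.perfectMatching,
      h.le_girth_expandRoot hB hA.perfectMatching hA.le_girth⟩,
    exists_isTreeLike t hr1, exists_isAuxiliary r t ht, fun C hC => hC.codeRate_le hr ht, ?_⟩
  obtain ⟨V, E, hV, hE, G, root, lev, a₀, h1, h2, h3⟩ := exists_isTreeLike_le_girth hr1 ht
  obtain ⟨h4, h5⟩ := h1.incidenceMatrix_code hr1
  exact ⟨V, E, hV, hE, G, root, lev, a₀, h1, h2, h3, h4.2 h3, h5 h2⟩
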